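/- All vector spaces, algebras and tensor products are over $\mathbb{C}$; modules over Lie superalgebras are $\mathbb{Z}_2$-graded, submodules are graded subspaces, and an irreducible module is a nonzero module whose only submodules are $0$ and itself. Let $n\ge 2$ and let $\mathfrak{q}=\mathfrak{q}(n)$ be the queer Lie superalgebra, i.e. the Lie superalgebra (under the supercommutator) of the complex matrices $\begin{pmatrix}X&Y\\Y&X\end{pmatrix}$ with blocks of size $n+1$ and $\operatorname{tr}Y=0$, modulo the scalar matrices. Let $A$ be a finitely generated commutative associative unital algebra and let $\Gamma$ be a finite abelian group acting on $\mathfrak{q}$ by Lie superalgebra automorphisms and on $A$ by algebra automorphisms, such that the induced action of $\Gamma$ on the set $\operatorname{MaxSpec}(A)$ of maximal ideals of $A$ is free. Let $(\mathfrak{q}\otimes A)^\Gamma$ be the fixed-point subalgebra of $\mathfrak{q}\otimes A$ (with $[x\otimes f,y\otimes g]=[x,y]\otimes fg$) under the diagonal action of $\Gamma$. The support of a $\mathfrak{q}\otimes A$-module $W$ is the set of maximal ideals of $A$ that contain the sum of all ideals $I\subseteq A$ with $(\mathfrak{q}\otimes I)W=0$. Let $X_*$ be the set of finite subsets of $\operatorname{MaxSpec}(A)$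 that contain at most one point of each $\Gamma$-orbit. Every finite-dimensional $(\mathfrak{q}\otimes A)^\Gamma$-module $V$ is the restriction of a $\mathfrak{q}\otimes A$-module $V'$ whose support is an element of $X_*$. Furthermore, for every such $V'$, the module $V$ is irreducible if and only if $V'$ is irreducible. -/

import Mathlib

open scoped TensorProduct

noncomputable section

/-- The sign `(-1)^{|a||b|}` for parities `i = |a|`, `j = |b|`. -/
def superSign (i j : ZMod 2) : ℂ := (-1) ^ (i.val * j.val)

theorem superSign_comm (i j : ZMod 2) : superSign i j = superSign j i := by
  rw [superSign, superSign, mul_comm]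

theorem superSign_mul_self (i j : ZMod 2) : superSign i j * superSign i j = 1 := by
  rw [superSign, ← mul_pow, neg_one_mul, neg_neg, one_pow]

theorem superSign_add_right (i j k : ZMod 2) :
    superSign i (j + k) = superSign i j * superSign i k := by
  have h : ∀ i j k : ZMod 2, (i.val * (j + k).val) % 2 = (i.val * j.val + i.val * k.val) % 2 := by
    decide
  rw [superSign, superSign, superSign, ← pow_add, neg_one_pow_eq_pow_mod_two, h,
    ← neg_one_pow_eq_pow_mod_two]

/-- A `ℤ/2`-graded complex vector space `V = V₀ ⊕ V₁`. -/
class SuperSpace (V : Type*) [AddCommGroup V] [Module ℂ V] where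
  part : ZMod 2 → Submodule ℂ V
  isCompl_part : IsCompl (part 0) (part 1)

namespace SuperSpace

variable {V : Type*} [AddCommGroup V] [Module ℂ V] [SuperSpace V]

/-- A linear subspace is graded if each of its elements is the sum of an even and an odd element of
the subspace. (These are the subspaces `W = W₀ ⊕ W₁` with `W_i ⊆ V_i`.) -/
def IsGraded (W : Submodule ℂ V) : Prop :=
  ∀ x ∈ W, ∃ a ∈ W, ∃ b ∈ W, a ∈ part 0 ∧ b ∈ part 1 ∧ x = a + b

theorem exists_decomp (x : V) :
    ∃ a ∈ part (V := V) 0, ∃ b ∈ part (V := V) 1, x = a + b := by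
  obtain ⟨a, ha, b, hb, h⟩ := Submodule.mem_sup.mp
    ((isCompl_part (V := V)).sup_eq_top ▸ Submodule.mem_top (x := x))
  exact ⟨a, ha, b, hb, h.symm⟩

theorem eq_zero_of_mem {x : V} (h0 : x ∈ part (V := V) 0) (h1 : x ∈ part (V := V) 1) : x = 0 :=
  Submodule.disjoint_def.mp (isCompl_part (V := V)).disjoint x h0 h1

end SuperSpace

open SuperSpace

/-- A complex Lie superalgebra. -/
class LieSuperalgebra (L : Type*) [AddCommGroup L] [Module ℂ L] extends SuperSpace L where
  bracket : L →ₗ[ℂ] L →ₗ[ℂ] L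
  bracket_mem : ∀ (i j : ZMod 2) (x y : L), x ∈ part i → y ∈ part j → bracket x y ∈ part (i + j)
  skew : ∀ (i j : ZMod 2) (x y : L), x ∈ part i → y ∈ part j →
    bracket x y = -(superSign i j • bracket y x)
  jacobi : ∀ (i j k : ZMod 2) (x y z : L), x ∈ part i → y ∈ part j → z ∈ part k →
    bracket x (bracket y z) = bracket (bracket x y) z + superSign i j • bracket y (bracket x z)

/-! ### Automorphisms, subalgebras, ideals and quotients -/

/-- The group of automorphisms of a Lie superalgebra: parity preserving linear automorphisms
compatible with the bracket. -/
def LieSuperalgebra.Aut (L : Type*) [AddCommGroup L] [Module ℂ L] [LieSuperalgebra L] :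
    Subgroup (L ≃ₗ[ℂ] L) where
  carrier := {f | (∀ (i : ZMod 2) (x : L), f x ∈ part i ↔ x ∈ part i) ∧
    ∀ x y : L, f (bracket x y) = bracket (f x) (f y)}
  mul_mem' := by
    rintro f g ⟨hf, hf'⟩ ⟨hg, hg'⟩
    exact ⟨fun i x => (hf i (g x)).trans (hg i x), fun x y => by
      simp [LinearEquiv.mul_apply, hg', hf']⟩
  one_mem' := ⟨fun _ _ => Iff.rfl, fun _ _ => rfl⟩
  inv_mem' := by
    rintro f ⟨hf, hf'⟩
    have key : ∀ x, f (f⁻¹ x) = x := fun x => f.apply_symm_apply x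
    refine ⟨fun i x => ?_, fun x y => ?_⟩
    · rw [← hf i (f⁻¹ x), key]
    · apply f.injective
      rw [hf', key, key, key]

/-- A (graded) subalgebra of a Lie superalgebra. -/
structure LieSubsuperalgebra (L : Type*) [AddCommGroup L] [Module ℂ L] [LieSuperalgebra L] extends
    Submodule ℂ L where
  graded : IsGraded toSubmodule
  bracket_mem' : ∀ x ∈ toSubmodule, ∀ y ∈ toSubmodule, LieSuperalgebra.bracket x y ∈ toSubmodule

/-- A (graded) ideal of a Lie superalgebra. -/
structure LieSuperIdeal (L : Type*) [AddCommGroup L] [Module ℂ L] [LieSuperalgebra L] extends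
    Submodule ℂ L where
  graded : IsGraded toSubmodule
  bracket_mem_right : ∀ x : L, ∀ y ∈ toSubmodule, LieSuperalgebra.bracket x y ∈ toSubmodule
  bracket_mem_left : ∀ x ∈ toSubmodule, ∀ y : L, LieSuperalgebra.bracket x y ∈ toSubmodule

namespace LieSubsuperalgebra

variable {L : Type*} [AddCommGroup L] [Module ℂ L] [LieSuperalgebra L]

/-- The Lie superalgebra structure of a subalgebra. -/
instance (S : LieSubsuperalgebra L) : LieSuperalgebra S.toSubmodule where
  part i := (part i).comap S.toSubmodule.subtype
  isCompl_part := by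
    refine ⟨Submodule.disjoint_def.mpr fun x h0 h1 => Subtype.ext (eq_zero_of_mem h0 h1),
      codisjoint_iff.mpr <| eq_top_iff.mpr fun x _ => ?_⟩
    obtain ⟨a, ha, b, hb, ha0, hb1, h⟩ := S.graded x.1 x.2
    exact Submodule.mem_sup.mpr ⟨⟨a, ha⟩, ha0, ⟨b, hb⟩, hb1, Subtype.ext h.symm⟩
  bracket := LinearMap.mk₂ ℂ
    (fun x y => ⟨LieSuperalgebra.bracket x.1 y.1, S.bracket_mem' _ x.2 _ y.2⟩)
    (fun _ _ _ => Subtype.ext (by simp)) (fun _ _ _ => Subtype.ext (by simp))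
    (fun _ _ _ => Subtype.ext (by simp)) (fun _ _ _ => Subtype.ext (by simp))
  bracket_mem i j x y hx hy := LieSuperalgebra.bracket_mem i j x.1 y.1 hx hy
  skew i j x y hx hy := Subtype.ext (LieSuperalgebra.skew i j x.1 y.1 hx hy)
  jacobi i j k x y z hx hy hz := Subtype.ext (LieSuperalgebra.jacobi i j k x.1 y.1 z.1 hx hy hz)

end LieSubsuperalgebra

namespace LieSuperIdeal

variable {L : Type*} [AddCommGroup L] [Module ℂ L] [LieSuperalgebra L]

/-- The bracket induced on the quotient by an ideal: `[x + I, y + I] = [x, y] + I`. -/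
def quotientBracket (I : LieSuperIdeal L) :
    (L ⧸ I.toSubmodule) →ₗ[ℂ] (L ⧸ I.toSubmodule) →ₗ[ℂ] (L ⧸ I.toSubmodule) :=
  I.toSubmodule.liftQ
    { toFun := fun x => I.toSubmodule.mapQ I.toSubmodule (LieSuperalgebra.bracket x)
        (fun y hy => I.bracket_mem_right x y hy)
      map_add' := fun x y => by
        apply Submodule.linearMap_qext
        ext z
        simp
      map_smul' := fun c x => by
        apply Submodule.linearMap_qext
        ext z
        simp }
    (fun x hx => by
      rw [LinearMap.mem_ker]
      apply Submodule.linearMap_qext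
      ext z
      simpa using I.bracket_mem_left x hx z)

@[simp] theorem quotientBracket_mk (I : LieSuperIdeal L) (x y : L) :
    I.quotientBracket (I.toSubmodule.mkQ x) (I.toSubmodule.mkQ y) =
      I.toSubmodule.mkQ (LieSuperalgebra.bracket x y) := rfl

/-- The Lie superalgebra structure of the quotient by an ideal. -/
instance (I : LieSuperIdeal L) : LieSuperalgebra (L ⧸ I.toSubmodule) where
  part i := (part i).map I.toSubmodule.mkQ
  isCompl_part := by
    refine ⟨Submodule.disjoint_def.mpr ?_, codisjoint_iff.mpr ?_⟩
    · rintro _ ⟨x, hx, rfl⟩ ⟨y, hy, hxy⟩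
      have hmem : x - y ∈ I.toSubmodule := by
        rw [← Submodule.Quotient.eq]
        exact hxy.symm
      obtain ⟨a, ha, b, hb, ha0, hb1, h⟩ := I.graded _ hmem
      have hxa : x - a = 0 := by
        refine eq_zero_of_mem ((part 0).sub_mem hx ha0) ?_
        have : x - a = y + b := by
          rw [sub_eq_iff_eq_add] at h ⊢
          rw [h]; abel
        rw [this]
        exact (part 1).add_mem hy hb1
      rw [sub_eq_zero.mp hxa]
      simpa using ha
    · rw [← Submodule.map_sup, isCompl_part.sup_eq_top, Submodule.map_top, Submodule.range_mkQ]
  bracket := I.quotientBracket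
  bracket_mem := by
    rintro i j _ _ ⟨x, hx, rfl⟩ ⟨y, hy, rfl⟩
    exact ⟨_, LieSuperalgebra.bracket_mem i j x y hx hy, rfl⟩
  skew := by
    rintro i j _ _ ⟨x, hx, rfl⟩ ⟨y, hy, rfl⟩
    simp only [quotientBracket_mk]
    rw [LieSuperalgebra.skew i j x y hx hy, map_neg, map_smul]
  jacobi := by
    rintro i j k _ _ _ ⟨x, hx, rfl⟩ ⟨y, hy, rfl⟩ ⟨z, hz, rfl⟩
    simp only [quotientBracket_mk]
    rw [LieSuperalgebra.jacobi i j k x y z hx hy hz, map_add, map_smul]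

end LieSuperIdeal

/-! ### The general linear Lie superalgebra `𝔤𝔩(p|q)` -/

/-- The parity of a basis vector of `ℂ^{p|q}`. -/
def basisParity {p q : ℕ} : Fin p ⊕ Fin q → ZMod 2 := Sum.elim (fun _ => 0) (fun _ => 1)

/-- Square matrices in `p|q`-block form. -/
abbrev SuperMatrix (p q : ℕ) : Type := Matrix (Fin p ⊕ Fin q) (Fin p ⊕ Fin q) ℂ

/-- The even (`i = 0`) or odd (`i = 1`) component of a matrix in block form. -/
def SuperMatrix.component {p q : ℕ} (i : ZMod 2) : SuperMatrix p q →ₗ[ℂ] SuperMatrix p q where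
  toFun T := Matrix.of fun a b => if basisParity a + basisParity b = i then T a b else 0
  map_add' S T := by ext a b; simp only [Matrix.of_apply, Matrix.add_apply]; split_ifs <;> simp
  map_smul' c T := by ext a b; simp

/-- The even matrices are the block diagonal ones, the odd matrices the block antidiagonal ones. -/
instance SuperMatrix.superSpace (p q : ℕ) : SuperSpace (SuperMatrix p q) where
  part i :=
    { carrier := {T | ∀ a b, basisParity a + basisParity b ≠ i → T a b = 0}
      add_mem' := fun hS hT a b h => by simp [hS a b h, hT a b h]
      zero_mem' := fun _ _ _ => rfl
      smul_mem' := fun c T hT a b h => by simp [hT a b h] }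
  isCompl_part := by
    have two : ∀ i : ZMod 2, i ≠ 1 → i = 0 := by decide
    refine ⟨Submodule.disjoint_def.mpr fun T h0 h1 => ?_,
      codisjoint_iff.mpr <| eq_top_iff.mpr fun T _ => ?_⟩
    · ext a b
      by_cases h : basisParity a + basisParity b = 0
      · exact h1 a b (by rw [h]; decide)
      · exact h0 a b h
    · refine Submodule.mem_sup.mpr ⟨SuperMatrix.component 0 T, fun a b h => ?_,
        SuperMatrix.component 1 T, fun a b h => ?_, ?_⟩
      · simp [SuperMatrix.component, h]
      · simp [SuperMatrix.component, h]
      · ext a b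
        by_cases h : basisParity a + basisParity b = 1
        · simp [SuperMatrix.component, h]
        · simp [SuperMatrix.component, two _ h]

theorem SuperMatrix.mem_part {p q : ℕ} {i : ZMod 2} {T : SuperMatrix p q} :
    T ∈ part i ↔ ∀ a b, basisParity a + basisParity b ≠ i → T a b = 0 := Iff.rfl

theorem SuperMatrix.component_of_mem {p q : ℕ} {i : ZMod 2} {T : SuperMatrix p q}
    (h : T ∈ part i) (j : ZMod 2) : component j T = if j = i then T else 0 := by
  ext a b
  by_cases hj : basisParity a + basisParity b = j
  · by_cases hi : j = i
    · simp [component, hj, hi]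
    · have := SuperMatrix.mem_part.mp h a b (by rw [hj]; exact hi)
      simp [component, hi, this]
  · by_cases hi : j = i
    · subst hi
      have := SuperMatrix.mem_part.mp h a b hj
      simp [component, this]
    · simp [component, hj, hi]

theorem SuperMatrix.mul_mem {p q : ℕ} {i j : ZMod 2} {S T : SuperMatrix p q}
    (hS : S ∈ part i) (hT : T ∈ part j) : S * T ∈ part (i + j) := by
  rw [SuperMatrix.mem_part] at *
  intro a b h
  rw [Matrix.mul_apply]
  refine Finset.sum_eq_zero fun c _ => ?_
  by_cases h1 : basisParity a + basisParity c = i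
  · by_cases h2 : basisParity c + basisParity b = j
    · exfalso
      apply h
      rw [← h1, ← h2]
      generalize basisParity a = x, basisParity b = y, basisParity c = z
      revert x y z
      decide
    · rw [hT c b h2, mul_zero]
  · rw [hS a c h1, zero_mul]

/-- The supercommutator, that is, the bilinear map with `[S, T] = S T - (-1)^{|S||T|} T S` for
homogeneous matrices `S` and `T`. -/
def SuperMatrix.superCommutator {p q : ℕ} :
    SuperMatrix p q →ₗ[ℂ] SuperMatrix p q →ₗ[ℂ] SuperMatrix p q :=
  LinearMap.mk₂ ℂ
    (fun S T => S * T - ∑ i : ZMod 2, ∑ j : ZMod 2,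
      superSign i j • (component j T * component i S))
    (fun S S' T => by
      simp only [map_add, add_mul, mul_add, smul_add, Finset.sum_add_distrib]; abel)
    (fun c S T => by
      simp only [map_smul, smul_mul_assoc, mul_smul_comm, smul_sub, Finset.smul_sum, smul_comm c])
    (fun S T T' => by
      simp only [map_add, add_mul, mul_add, smul_add, Finset.sum_add_distrib]; abel)
    (fun c S T => by
      simp only [map_smul, smul_mul_assoc, mul_smul_comm, smul_sub, Finset.smul_sum, smul_comm c])

theorem SuperMatrix.superCommutator_of_mem {p q : ℕ} {i j : ZMod 2} {S T : SuperMatrix p q}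
    (hS : S ∈ part i) (hT : T ∈ part j) :
    superCommutator S T = S * T - superSign i j • (T * S) := by
  change S * T - ∑ i' : ZMod 2, ∑ j' : ZMod 2, _ = _
  congr 1
  rw [Finset.sum_eq_single i, Finset.sum_eq_single j]
  · rw [component_of_mem hS, component_of_mem hT, if_pos rfl, if_pos rfl]
  · intro k _ hk
    rw [component_of_mem hT, if_neg hk, zero_mul, smul_zero]
  · simp
  · intro k _ hk
    refine Finset.sum_eq_zero fun l _ => ?_
    rw [component_of_mem hS, if_neg hk, mul_zero, smul_zero]
  · simp

theorem SuperMatrix.superCommutator_mem {p q : ℕ} {i j : ZMod 2} {S T : SuperMatrix p q}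
    (hS : S ∈ part i) (hT : T ∈ part j) : superCommutator S T ∈ part (i + j) := by
  rw [superCommutator_of_mem hS hT]
  exact Submodule.sub_mem _ (mul_mem hS hT)
    (Submodule.smul_mem _ _ (add_comm j i ▸ mul_mem hT hS))

/-- The general linear Lie superalgebra `𝔤𝔩(p|q)`. -/
instance SuperMatrix.lieSuperalgebra (p q : ℕ) : LieSuperalgebra (SuperMatrix p q) where
  bracket := SuperMatrix.superCommutator
  bracket_mem _ _ _ _ hS hT := SuperMatrix.superCommutator_mem hS hT
  skew i j S T hS hT := by
    rw [SuperMatrix.superCommutator_of_mem hS hT, SuperMatrix.superCommutator_of_mem hT hS]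
    rw [smul_sub, smul_smul, superSign_comm j i, superSign_mul_self, one_smul, neg_sub]
  jacobi i j k S T U hS hT hU := by
    rw [SuperMatrix.superCommutator_of_mem hS (SuperMatrix.superCommutator_mem hT hU),
      SuperMatrix.superCommutator_of_mem (SuperMatrix.superCommutator_mem hS hT) hU,
      SuperMatrix.superCommutator_of_mem hT (SuperMatrix.superCommutator_mem hS hU),
      SuperMatrix.superCommutator_of_mem hS hT, SuperMatrix.superCommutator_of_mem hT hU,
      SuperMatrix.superCommutator_of_mem hS hU]
    have e4 := superSign_mul_self i j
    rw [superSign_add_right, superSign_add_right, superSign_comm (i + j) k, superSign_add_right,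
      superSign_comm k i, superSign_comm k j, superSign_comm j i]
    generalize superSign i j = a at *
    generalize superSign i k = b at *
    generalize superSign j k = c at *
    have e5 : ∀ M : SuperMatrix p q, a • (a * c) • M = c • M := fun M => by
      rw [smul_smul, ← mul_assoc, e4, one_mul]
    simp only [smul_sub, e5]
    simp only [mul_sub, sub_mul, mul_smul_comm, smul_mul_assoc, mul_assoc, smul_sub]
    module

/-! ### The queer Lie superalgebra `𝔮(n)` -/

/-- The even matrix with diagonal blocks `A`. -/
theorem SuperMatrix.even_mem {m : ℕ} (A : Matrix (Fin m) (Fin m) ℂ) :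
    (Matrix.fromBlocks A 0 0 A : SuperMatrix m m) ∈ part 0 := by
  rw [SuperMatrix.mem_part]
  rintro (a | a) (b | b) h <;> simp [basisParity] at h ⊢
  exact absurd (by decide) h

/-- The odd matrix with antidiagonal blocks `B`. -/
theorem SuperMatrix.odd_mem {m : ℕ} (B : Matrix (Fin m) (Fin m) ℂ) :
    (Matrix.fromBlocks 0 B B 0 : SuperMatrix m m) ∈ part 1 := by
  rw [SuperMatrix.mem_part]
  rintro (a | a) (b | b) h <;> simp [basisParity] at h ⊢

/-- The supercommutator of two matrices of the form `(A B; B A)`. -/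
theorem SuperMatrix.superCommutator_queer {m : ℕ} (A B C D : Matrix (Fin m) (Fin m) ℂ) :
    superCommutator (Matrix.fromBlocks A B B A : SuperMatrix m m) (Matrix.fromBlocks C D D C) =
      Matrix.fromBlocks (A * C - C * A + (B * D + D * B)) (A * D - D * A + (B * C - C * B))
        (A * D - D * A + (B * C - C * B)) (A * C - C * A + (B * D + D * B)) := by
  have h : ∀ A B : Matrix (Fin m) (Fin m) ℂ, (Matrix.fromBlocks A B B A : SuperMatrix m m) =
      Matrix.fromBlocks A 0 0 A + Matrix.fromBlocks 0 B B 0 := by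
    intro A B
    simp [Matrix.fromBlocks_add]
  rw [h A B, h C D, map_add, map_add, LinearMap.add_apply, LinearMap.add_apply,
    superCommutator_of_mem (even_mem A) (even_mem C),
    superCommutator_of_mem (even_mem A) (odd_mem D),
    superCommutator_of_mem (odd_mem B) (even_mem C),
    superCommutator_of_mem (odd_mem B) (odd_mem D)]
  simp only [superSign, ZMod.val_zero, ZMod.val_one, Matrix.fromBlocks_multiply, mul_zero,
    zero_mul, mul_one, pow_zero, pow_one, one_smul, neg_smul,
    Matrix.fromBlocks_add, sub_eq_add_neg, Matrix.fromBlocks_neg, add_zero, zero_add, neg_zero]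
  congr 1 <;> abel

/-- The Lie superalgebra of the complex matrices `(A B; B A)` with blocks of size `n + 1` and
`tr B = 0`. It is the derived subalgebra of the Lie superalgebra of all matrices `(A B; B A)`. -/
def queerTilde (n : ℕ) : LieSubsuperalgebra (SuperMatrix (n + 1) (n + 1)) where
  carrier := {T | ∃ A B : Matrix (Fin (n + 1)) (Fin (n + 1)) ℂ,
    B.trace = 0 ∧ T = Matrix.fromBlocks A B B A}
  add_mem' := by
    rintro _ _ ⟨A, B, h, rfl⟩ ⟨C, D, h', rfl⟩
    exact ⟨A + C, B + D, by simp [h, h'], by simp [Matrix.fromBlocks_add]⟩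
  zero_mem' := ⟨0, 0, by simp, by simp⟩
  smul_mem' := by
    rintro c _ ⟨A, B, h, rfl⟩
    exact ⟨c • A, c • B, by simp [h], by simp [Matrix.fromBlocks_smul]⟩
  graded := by
    rintro _ ⟨A, B, h, rfl⟩
    exact ⟨Matrix.fromBlocks A 0 0 A, ⟨A, 0, by simp, rfl⟩, Matrix.fromBlocks 0 B B 0,
      ⟨0, B, h, rfl⟩, SuperMatrix.even_mem A, SuperMatrix.odd_mem B,
      by simp [Matrix.fromBlocks_add]⟩
  bracket_mem' := by
    rintro _ ⟨A, B, h, rfl⟩ _ ⟨C, D, h', rfl⟩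
    refine ⟨_, _, ?_, SuperMatrix.superCommutator_queer A B C D⟩
    simp [Matrix.trace_mul_comm A D, Matrix.trace_mul_comm B C]

theorem SuperMatrix.one_mem_part {p q : ℕ} : (1 : SuperMatrix p q) ∈ part 0 := by
  rw [mem_part]
  intro a b h
  refine Matrix.one_apply_ne ?_
  rintro rfl
  refine h ?_
  generalize basisParity a = x
  revert x
  decide

theorem SuperMatrix.superCommutator_one_right {p q : ℕ} (S : SuperMatrix p q) :
    superCommutator S 1 = 0 := by
  obtain ⟨a, ha, b, hb, rfl⟩ := exists_decomp S
  rw [map_add, LinearMap.add_apply, superCommutator_of_mem ha one_mem_part,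
    superCommutator_of_mem hb one_mem_part]
  simp [superSign]

theorem SuperMatrix.superCommutator_one_left {p q : ℕ} (S : SuperMatrix p q) :
    superCommutator 1 S = 0 := by
  obtain ⟨a, ha, b, hb, rfl⟩ := exists_decomp S
  rw [map_add, superCommutator_of_mem one_mem_part ha, superCommutator_of_mem one_mem_part hb]
  simp [superSign]

/-- The ideal of scalar matrices. -/
def queerCenter (n : ℕ) : LieSuperIdeal (queerTilde n).toSubmodule where
  toSubmodule := (Submodule.span ℂ {(1 : SuperMatrix (n + 1) (n + 1))}).comap
    (queerTilde n).toSubmodule.subtype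
  graded := by
    intro x hx
    refine ⟨x, hx, 0, Submodule.zero_mem _, ?_, Submodule.zero_mem _, (add_zero x).symm⟩
    obtain ⟨c, hc⟩ := Submodule.mem_span_singleton.mp hx
    obtain ⟨y, hy⟩ := x
    change c • (1 : SuperMatrix (n + 1) (n + 1)) = y at hc
    subst hc
    change c • (1 : SuperMatrix (n + 1) (n + 1)) ∈ part 0
    exact Submodule.smul_mem _ _ SuperMatrix.one_mem_part
  bracket_mem_right := by
    rintro x ⟨y, hy'⟩ hy
    obtain ⟨c, hc⟩ := Submodule.mem_span_singleton.mp hy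
    change c • (1 : SuperMatrix (n + 1) (n + 1)) = y at hc
    subst hc
    change SuperMatrix.superCommutator x.1 (c • 1) ∈
      Submodule.span ℂ {(1 : SuperMatrix (n + 1) (n + 1))}
    rw [map_smul, SuperMatrix.superCommutator_one_right, smul_zero]
    exact Submodule.zero_mem _
  bracket_mem_left := by
    rintro ⟨y, hy'⟩ hy x
    obtain ⟨c, hc⟩ := Submodule.mem_span_singleton.mp hy
    change c • (1 : SuperMatrix (n + 1) (n + 1)) = y at hc
    subst hc
    change SuperMatrix.superCommutator (c • 1) x.1 ∈
      Submodule.span ℂ {(1 : SuperMatrix (n + 1) (n + 1))}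
    rw [map_smul, LinearMap.smul_apply, SuperMatrix.superCommutator_one_left, smul_zero]
    exact Submodule.zero_mem _

/-- The queer Lie superalgebra `𝔮(n)`: the matrices `(A B; B A)` with blocks of size `n + 1` and
`tr B = 0`, modulo the scalar matrices. -/
abbrev Queer (n : ℕ) : Type := (queerTilde n).toSubmodule ⧸ (queerCenter n).toSubmodule

/-! ### Map superalgebras and equivariant map superalgebras -/

section Map

variable {L A : Type*} [AddCommGroup L] [Module ℂ L] [LieSuperalgebra L] [CommRing A] [Algebra ℂ A]

@[elab_as_elim]
theorem tensor_part_induction {i : ZMod 2} {P : L ⊗[ℂ] A → Prop}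
    (h0 : P 0) (hadd : ∀ x y, P x → P y → P (x + y))
    (hP : ∀ x ∈ part (V := L) i, ∀ a : A, P (x ⊗ₜ a)) (x : L ⊗[ℂ] A)
    (hx : x ∈ LinearMap.range ((part (V := L) i).subtype.rTensor A)) : P x := by
  obtain ⟨t, rfl⟩ := hx
  induction t using TensorProduct.induction_on with
  | zero => rwa [map_zero]
  | tmul u a => exact hP u.1 u.2 a
  | add u v hu hv => rw [map_add]; exact hadd _ _ hu hv

/-- The Lie superalgebra `L ⊗ A`, with `(L ⊗ A)_i = L_i ⊗ A` and `[x ⊗ f, y ⊗ g] = [x, y] ⊗ f g`. -/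
instance mapSuperalgebra : LieSuperalgebra (L ⊗[ℂ] A) where
  part i := LinearMap.range ((part (V := L) i).subtype.rTensor A)
  isCompl_part := by
    constructor
    · rw [Submodule.disjoint_def]
      intro x h0 h1
      set π := (part (V := L) 0).projection (part 1) isCompl_part with hπ
      have e0 : π.rTensor A x = x := by
        refine tensor_part_induction (P := fun x => π.rTensor A x = x) ?_ ?_ ?_ x h0
        · simp
        · intro x y hx hy; rw [map_add, hx, hy]
        · intro x hx a
          have : π x = x := Submodule.projection_apply_left isCompl_part ⟨x, hx⟩
          simp [this]
      have e1 : π.rTensor A x = 0 := by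
        refine tensor_part_induction (P := fun x => π.rTensor A x = 0) ?_ ?_ ?_ x h1
        · simp
        · intro x y hx hy; rw [map_add, hx, hy, add_zero]
        · intro x hx a
          have : π x = 0 := Submodule.projection_apply_right isCompl_part ⟨x, hx⟩
          simp [this]
      rw [← e0, e1]
    · rw [codisjoint_iff, eq_top_iff]
      intro x _
      induction x using TensorProduct.induction_on with
      | zero => exact Submodule.zero_mem _
      | tmul x a =>
        obtain ⟨u, hu, v, hv, rfl⟩ := exists_decomp x
        rw [TensorProduct.add_tmul]
        exact Submodule.add_mem_sup ⟨⟨u, hu⟩ ⊗ₜ a, rfl⟩ ⟨⟨v, hv⟩ ⊗ₜ a, rfl⟩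
      | add x y hx hy => exact Submodule.add_mem _ (hx trivial) (hy trivial)
  bracket := TensorProduct.map₂ LieSuperalgebra.bracket (LinearMap.mul ℂ A)
  bracket_mem i j x y hx hy := by
    revert y
    refine tensor_part_induction ?_ ?_ ?_ x hx
    · intro y _; simp
    · intro x x' h h' y hy
      rw [map_add, LinearMap.add_apply]
      exact Submodule.add_mem _ (h y hy) (h' y hy)
    · intro x hx a y hy
      refine tensor_part_induction ?_ ?_ ?_ y hy
      · simp
      · intro y y' h h'
        rw [map_add]
        exact Submodule.add_mem _ h h'
      · intro y hy b
        exact ⟨⟨_, LieSuperalgebra.bracket_mem i j x y hx hy⟩ ⊗ₜ (a * b), rfl⟩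
  skew i j x y hx hy := by
    revert y
    refine tensor_part_induction ?_ ?_ ?_ x hx
    · intro y _; simp
    · intro x x' h h' y hy
      rw [map_add, LinearMap.add_apply, map_add, h y hy, h' y hy, smul_add, neg_add]
    · intro x hx a y hy
      refine tensor_part_induction ?_ ?_ ?_ y hy
      · simp
      · intro y y' h h'
        rw [map_add, LinearMap.map_add, LinearMap.add_apply, h, h', smul_add, neg_add]
      · intro y hy b
        simp only [TensorProduct.map₂_apply_tmul, TensorProduct.map_tmul, LinearMap.mul_apply']
        rw [LieSuperalgebra.skew i j x y hx hy, TensorProduct.neg_tmul, TensorProduct.smul_tmul',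
          mul_comm a b]
  jacobi i j k x y z hx hy hz := by
    revert y z
    refine tensor_part_induction ?_ ?_ ?_ x hx
    · intro y z _ _; simp
    · intro x x' h h' y z hy hz
      simp only [map_add, LinearMap.add_apply, h y z hy hz, h' y z hy hz, smul_add]
      abel
    · intro x hx a y z hy hz
      revert z
      refine tensor_part_induction ?_ ?_ ?_ y hy
      · intro z _; simp
      · intro y y' h h' z hz
        simp only [map_add, LinearMap.add_apply, h z hz, h' z hz, smul_add]
        abel
      · intro y hy b z hz
        refine tensor_part_induction ?_ ?_ ?_ z hz
        · simp
        · intro z z' h h'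
          simp only [map_add, h, h', smul_add]
          abel
        · intro z hz c
          simp only [TensorProduct.map₂_apply_tmul, TensorProduct.map_tmul, LinearMap.mul_apply']
          rw [LieSuperalgebra.jacobi i j k x y z hx hy hz, TensorProduct.add_tmul,
            TensorProduct.smul_tmul', mul_assoc, mul_left_comm b a c]

variable {Γ : Type*} [Group Γ] (σ : Γ →* LieSuperalgebra.Aut L) (τ : Γ →* (A ≃ₐ[ℂ] A))

/-- The diagonal action of `γ` on `L ⊗ A`, given by `γ (x ⊗ f) = γ x ⊗ γ f`. -/
def diagonalAction (γ : Γ) : L ⊗[ℂ] A →ₗ[ℂ] L ⊗[ℂ] A :=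
  TensorProduct.map ((σ γ : L ≃ₗ[ℂ] L) : L →ₗ[ℂ] L) (τ γ).toLinearMap

theorem diagonalAction_mem_part (γ : Γ) (i : ZMod 2) (x : L ⊗[ℂ] A) (hx : x ∈ part i) :
    diagonalAction σ τ γ x ∈ part i := by
  refine tensor_part_induction ?_ ?_ ?_ x hx
  · rw [map_zero]; exact Submodule.zero_mem _
  · intro x y h h'
    rw [map_add]
    exact Submodule.add_mem _ h h'
  · intro x hx a
    exact ⟨⟨(σ γ : L ≃ₗ[ℂ] L) x, ((σ γ).2.1 i x).mpr hx⟩ ⊗ₜ τ γ a, rfl⟩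

theorem diagonalAction_bracket (γ : Γ) (x y : L ⊗[ℂ] A) :
    diagonalAction σ τ γ (LieSuperalgebra.bracket x y) =
      LieSuperalgebra.bracket (diagonalAction σ τ γ x) (diagonalAction σ τ γ y) := by
  induction x using TensorProduct.induction_on with
  | zero => simp
  | add x x' h h' => simp only [map_add, LinearMap.add_apply, h, h']
  | tmul x a =>
    induction y using TensorProduct.induction_on with
    | zero => simp
    | add y y' h h' => simp only [map_add, h, h']
    | tmul y b =>
      change ((σ γ : L ≃ₗ[ℂ] L) (LieSuperalgebra.bracket x y)) ⊗ₜ[ℂ] (τ γ (a * b)) =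
        (LieSuperalgebra.bracket ((σ γ : L ≃ₗ[ℂ] L) x) ((σ γ : L ≃ₗ[ℂ] L) y)) ⊗ₜ[ℂ]
          (τ γ a * τ γ b)
      rw [(σ γ).2.2, map_mul]

/-- The equivariant map superalgebra `(L ⊗ A)^Γ`, the fixed points of the diagonal action. -/
def equivariantMap : LieSubsuperalgebra (L ⊗[ℂ] A) where
  carrier := {z | ∀ γ : Γ, diagonalAction σ τ γ z = z}
  add_mem' hx hy γ := by rw [map_add, hx γ, hy γ]
  zero_mem' γ := map_zero _
  smul_mem' c x hx γ := by rw [map_smul, hx γ]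
  graded := by
    intro x hx
    obtain ⟨a, ha, b, hb, rfl⟩ := exists_decomp x
    have key : ∀ γ : Γ, diagonalAction σ τ γ a - a = 0 := by
      intro γ
      refine eq_zero_of_mem (Submodule.sub_mem _ (diagonalAction_mem_part σ τ γ 0 a ha) ha) ?_
      have h := hx γ
      rw [map_add] at h
      have : diagonalAction σ τ γ a - a = b - diagonalAction σ τ γ b := by
        rw [sub_eq_sub_iff_add_eq_add, h, add_comm]
      rw [this]
      exact Submodule.sub_mem _ hb (diagonalAction_mem_part σ τ γ 1 b hb)
    have ha' : ∀ γ : Γ, diagonalAction σ τ γ a = a := fun γ => sub_eq_zero.mp (key γ)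
    refine ⟨a, ha', b, fun γ => ?_, ha, hb, rfl⟩
    have h := hx γ
    rw [map_add, ha' γ] at h
    exact add_left_cancel h
  bracket_mem' x hx y hy γ := by rw [diagonalAction_bracket, hx γ, hy γ]

/-- The action of an automorphism of `A` on the maximal ideals of `A`. -/
def maxSpecMap (e : A ≃ₐ[ℂ] A) (m : MaximalSpectrum A) : MaximalSpectrum A :=
  ⟨m.asIdeal.map e, Ideal.map_isMaximal_of_equiv e⟩

/-- The set `X_*` of the finite sets of maximal ideals of `A` that do not contain two distinct
elements of one `Γ`-orbit. -/
def XStar : Set (Set (MaximalSpectrum A)) :=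
  {M | M.Finite ∧ ∀ m ∈ M, ∀ m' ∈ M, m ≠ m' → ∀ γ : Γ, maxSpecMap (τ γ) m ≠ m'}

end Map

/-! ### Modules -/

/-- A representation of the Lie superalgebra `L` on the `ℤ/2`-graded vector space `V`, that is, an
`L`-module structure on `V`. -/
structure SuperRep (L V : Type*) [AddCommGroup L] [Module ℂ L] [LieSuperalgebra L]
    [AddCommGroup V] [Module ℂ V] [SuperSpace V] where
  act : L →ₗ[ℂ] V →ₗ[ℂ] V
  act_mem : ∀ (i j : ZMod 2) (x : L) (v : V), x ∈ part i → v ∈ part j → act x v ∈ part (i + j)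
  act_bracket : ∀ (i j : ZMod 2) (x y : L), x ∈ part i → y ∈ part j → ∀ v : V,
    act (LieSuperalgebra.bracket x y) v = act x (act y v) - superSign i j • act y (act x v)

namespace SuperRep

variable {L V : Type*} [AddCommGroup L] [Module ℂ L] [LieSuperalgebra L]
  [AddCommGroup V] [Module ℂ V] [SuperSpace V]

/-- The restriction of a module to a subalgebra. -/
def restrict (ρ : SuperRep L V) (S : LieSubsuperalgebra L) : SuperRep S.toSubmodule V where
  act := ρ.act ∘ₗ S.toSubmodule.subtype
  act_mem i j x v hx hv := ρ.act_mem i j x.1 v hx hv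
  act_bracket i j x y hx hy v := ρ.act_bracket i j x.1 y.1 hx hy v

/-- A module is irreducible if it is nonzero and has no (graded) submodules besides zero and
itself. -/
def IsIrreducible (ρ : SuperRep L V) : Prop :=
  Nontrivial V ∧ ∀ W : Submodule ℂ V, IsGraded W → (∀ x : L, ∀ w ∈ W, ρ.act x w ∈ W) →
    W = ⊥ ∨ W = ⊤

variable {A : Type*} [CommRing A] [Algebra ℂ A]

/-- The annihilator in `A` of an `L ⊗ A`-module: the sum of all ideals `I` of `A` such that
`L ⊗ I` acts by zero. -/
def annihilator (ρ : SuperRep (L ⊗[ℂ] A) V) : Ideal A :=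
  sSup {I : Ideal A | ∀ x : L, ∀ f ∈ I, ρ.act (x ⊗ₜ f) = 0}

/-- The support of an `L ⊗ A`-module: the maximal ideals of `A` that contain its annihilator. -/
def support (ρ : SuperRep (L ⊗[ℂ] A) V) : Set (MaximalSpectrum A) :=
  {m | ρ.annihilator ≤ m.asIdeal}

end SuperRep

end

/-! Write L for the Lie superalgebra. The point is that, modulo L ⊗ J for a suitable ideal J, every
element of L ⊗ A agrees with a fixed one. If the zeros of J meet each orbit at most once, freeness
makes J comaximal with its nontrivial conjugates, so there is e in A with e ≡ 1 mod J and γ(e) ∈ J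
for γ ≠ 1 (`exists_separating`). Then P z = ∑ γ(e z) is fixed and P z ≡ z mod L ⊗ J.

Irreducibility: take J to be the annihilator of V'. Then z and P z act alike, so both algebras act
by the same operators and have the same submodules.

Extension: V is extended by letting z act as P z. This is a representation restricting to V once the
fixed elements of L ⊗ J act by zero. To find J, let I be the largest ideal such that traces of L ⊗ I
kill V. It is invariant, and it has finite codimension
(`finiteDimensional_quotient_traceAnnihilator`): freeness gives elements a_i, b_i with ∑ a_i γ(b_i)
= δ_{γ,1} (`exists_galois_element`), which write the trace of [u,v] ⊗ fg as a sum of brackets of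
traces, and L is perfect (`queer_isPerfect`). Choosing one zero of I per orbit, and taking a power
of the intersection of the chosen maximal ideals, gives J whose conjugates intersect inside I
(`exists_orbit_representative_ideal`). -/

noncomputable section

open SuperSpace

/-! ### Free actions on the maximal spectrum: comaximality, Galois elements, orbit representatives.
-/

section FreeAction

variable {A : Type*} [CommRing A] [Algebra ℂ A] {Γ : Type*} [Group Γ] {τ : Γ →* (A ≃ₐ[ℂ] A)}

theorem algAut_mul_apply (γ δ : Γ) (a : A) : τ (γ * δ) a = τ γ (τ δ a) := by
  rw [map_mul]; rfl

theorem algAut_inv_apply_apply (γ : Γ) (a : A) : τ γ⁻¹ (τ γ a) = a := by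
  rw [← algAut_mul_apply, inv_mul_cancel, map_one]; rfl

theorem algAut_apply_inv_apply (γ : Γ) (a : A) : τ γ (τ γ⁻¹ a) = a := by
  rw [← algAut_mul_apply, mul_inv_cancel, map_one]; rfl

theorem comap_eq_map_inv (γ : Γ) (I : Ideal A) : I.comap (τ γ) = I.map (τ γ⁻¹) := by
  refine le_antisymm (fun a ha => ?_) (Ideal.map_le_iff_le_comap.mpr fun a ha => ?_)
  · rw [← algAut_inv_apply_apply (τ := τ) γ a]
    exact Ideal.mem_map_of_mem _ ha
  · rw [Ideal.mem_comap, Ideal.mem_comap, algAut_apply_inv_apply]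
    exact ha

theorem le_maxSpecMap {J : Ideal A} {γ : Γ} {m : MaximalSpectrum A}
    (h : J.comap (τ γ) ≤ m.asIdeal) : J ≤ (maxSpecMap (τ γ) m).asIdeal := by
  intro f hf
  rw [← algAut_apply_inv_apply (τ := τ) γ f]
  refine Ideal.mem_map_of_mem (τ γ) (h ?_)
  rw [Ideal.mem_comap]
  rwa [algAut_apply_inv_apply]

theorem maxSpecMap_eq_of_forall_mem {γ : Γ} {m : MaximalSpectrum A}
    (h : ∀ a ∈ m.asIdeal, τ γ a ∈ m.asIdeal) : maxSpecMap (τ γ) m = m := by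
  refine MaximalSpectrum.ext ?_
  refine (maxSpecMap (τ γ) m).isMaximal.eq_of_le m.isMaximal.ne_top ?_
  exact Ideal.map_le_iff_le_comap.mpr fun a ha => h a ha

theorem maxSpecMap_one (m : MaximalSpectrum A) : maxSpecMap (τ 1) m = m :=
  maxSpecMap_eq_of_forall_mem fun a ha => by rw [map_one]; exact ha

theorem maxSpecMap_mul (γ δ : Γ) (m : MaximalSpectrum A) :
    maxSpecMap (τ (γ * δ)) m = maxSpecMap (τ γ) (maxSpecMap (τ δ) m) := by
  refine MaximalSpectrum.ext ?_
  refine (maxSpecMap (τ (γ * δ)) m).isMaximal.eq_of_le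
    (maxSpecMap (τ γ) (maxSpecMap (τ δ) m)).isMaximal.ne_top ?_
  refine Ideal.map_le_iff_le_comap.mpr fun a ha => ?_
  rw [Ideal.mem_comap]
  rw [algAut_mul_apply]
  exact Ideal.mem_map_of_mem (τ γ) (Ideal.mem_map_of_mem (τ δ) ha)

variable (hfree : ∀ (γ : Γ) (m : MaximalSpectrum A), maxSpecMap (τ γ) m = m → γ = 1)

include hfree

/-- A maximal ideal m above both ideals would make m and γm zeros of J in one orbit, and they are
distinct because the action is free. -/
theorem sup_comap_eq_top {J : Ideal A} (hJ : {m : MaximalSpectrum A | J ≤ m.asIdeal} ∈ XStar τ)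
    {γ : Γ} (hγ : γ ≠ 1) : J ⊔ J.comap (τ γ) = ⊤ := by
  by_contra h
  obtain ⟨m, hm, hle⟩ := Ideal.exists_le_maximal _ h
  have h1 : J ≤ m := le_sup_left.trans hle
  have h2 : J ≤ (maxSpecMap (τ γ) ⟨m, hm⟩).asIdeal := le_maxSpecMap (le_sup_right.trans hle)
  refine hγ (hfree γ ⟨m, hm⟩ ?_)
  by_contra hne
  exact hJ.2 ⟨m, hm⟩ h1 _ h2 (Ne.symm hne) γ rfl

/-- Translation by γ reduces this to J and its preimage under δγ⁻¹. -/
theorem isCoprime_comap_comap {J : Ideal A}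
    (hJ : {m : MaximalSpectrum A | J ≤ m.asIdeal} ∈ XStar τ) {γ δ : Γ} (hγ : γ ≠ δ) :
    IsCoprime (J.comap (τ γ)) (J.comap (τ δ)) := by
  have h := sup_comap_eq_top hfree hJ (γ := δ * γ⁻¹) (by rwa [Ne, mul_inv_eq_one, eq_comm])
  rw [Ideal.isCoprime_iff_exists]
  obtain ⟨a, ha, b, hb, hab⟩ := Submodule.mem_sup.mp ((Ideal.eq_top_iff_one _).mp h)
  refine ⟨τ γ⁻¹ a, ?_, τ γ⁻¹ b, ?_, ?_⟩
  · rw [Ideal.mem_comap]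
    rwa [algAut_apply_inv_apply]
  · rw [Ideal.mem_comap]
    rw [← algAut_mul_apply]
    exact hb
  · rw [← map_add, hab, map_one]

/-- An element of `A` that is `1` modulo `J` and vanishes modulo all other conjugates of `J`. -/
theorem exists_separating [Finite Γ] {J : Ideal A}
    (hJ : {m : MaximalSpectrum A | J ≤ m.asIdeal} ∈ XStar τ) :
    ∃ e : A, 1 - e ∈ J ∧ ∀ γ : Γ, γ ≠ 1 → τ γ e ∈ J := by
  classical
  cases nonempty_fintype Γ
  -- An ideal comaximal with each of finitely many ideals is comaximal with their intersection; e is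
  -- the component of 1 in that intersection.
  have h : J ⊔ ⨅ γ ∈ Finset.univ.erase (1 : Γ), J.comap (τ γ) = ⊤ :=
    Ideal.sup_iInf_eq_top fun γ hγ => sup_comap_eq_top hfree hJ (Finset.ne_of_mem_erase hγ)
  obtain ⟨a, ha, e, he, hae⟩ := Submodule.mem_sup.mp ((Ideal.eq_top_iff_one _).mp h)
  refine ⟨e, by rwa [← hae, add_sub_cancel_right], fun γ hγ => ?_⟩
  simp only [Submodule.mem_iInf] at he
  exact he γ (Finset.mem_erase.mpr ⟨hγ, Finset.mem_univ _⟩)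

/-- A free action on the maximal spectrum is Galois. -/
theorem exists_galois_element [Finite Γ] :
    ∃ S : Finset (A × A), (∑ p ∈ S, p.1 * p.2 = 1) ∧
      ∀ γ : Γ, γ ≠ 1 → ∑ p ∈ S, p.1 * τ γ p.2 = 0 := by
  classical
  cases nonempty_fintype Γ
  -- The kernel of `μ γ` cuts out the graph of γ in Spec A × Spec A. Freeness says that the graph of
  -- γ ≠ 1 misses the diagonal, so the kernels of `μ 1` and `μ γ` are comaximal.
  let μ : Γ → (A ⊗[ℂ] A →ₐ[ℂ] A) := fun γ =>
    Algebra.TensorProduct.lift (AlgHom.id ℂ A) (τ γ : A →ₐ[ℂ] A) fun _ _ => mul_comm _ _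
  have hμ : ∀ γ a b, μ γ (a ⊗ₜ b) = a * τ γ b := fun γ a b =>
    Algebra.TensorProduct.lift_tmul _ _ _ _ _
  have hμ1 : ∀ a b, μ 1 (a ⊗ₜ b) = a * b := fun a b => by rw [hμ, map_one]; rfl
  have h : RingHom.ker (μ 1) ⊔ ⨅ γ ∈ Finset.univ.erase (1 : Γ), RingHom.ker (μ γ) = ⊤ := by
    refine Ideal.sup_iInf_eq_top fun γ hγ => ?_
    have hγ1 := Finset.ne_of_mem_erase hγ
    have hsurj : Function.Surjective (μ 1) := fun a => ⟨a ⊗ₜ 1, by rw [hμ1, mul_one]⟩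
    have htop : (RingHom.ker (μ γ)).map (μ 1) = ⊤ := by
      by_contra hne
      obtain ⟨m, hm, hle⟩ := Ideal.exists_le_maximal _ hne
      refine hγ1 (hfree γ ⟨m, hm⟩ (maxSpecMap_eq_of_forall_mem fun a ha => ?_))
      -- Under `μ 1` this element becomes a - γ(a), so m contains a - γ(a) for every a in m and is
      -- therefore fixed by γ.
      have hk : (1 : A) ⊗ₜ[ℂ] a - τ γ a ⊗ₜ 1 ∈ RingHom.ker (μ γ) := by
        rw [RingHom.mem_ker, map_sub, hμ, hμ, map_one, one_mul, mul_one, sub_self]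
      have := hle (Ideal.mem_map_of_mem (μ 1) hk)
      rw [map_sub, hμ1, hμ1, one_mul, mul_one] at this
      have h' := m.sub_mem ha this
      rwa [sub_sub_cancel] at h'
    obtain ⟨t, ht, ht1⟩ := (Ideal.mem_map_iff_of_surjective (μ 1) hsurj).mp
      ((Ideal.eq_top_iff_one _).mp htop)
    rw [Ideal.eq_top_iff_one]
    refine Submodule.mem_sup.mpr ⟨1 - t, ?_, t, ht, sub_add_cancel _ _⟩
    rw [RingHom.mem_ker, map_sub, ht1, map_one, sub_self]
  obtain ⟨s, hs, t, ht, hst⟩ := Submodule.mem_sup.mp ((Ideal.eq_top_iff_one _).mp h)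
  obtain ⟨S, hS⟩ := TensorProduct.exists_finset t
  refine ⟨S, ?_, fun γ hγ => ?_⟩
  · have h1 : μ 1 t = 1 := by
      rw [← map_one (μ 1), ← hst, map_add, RingHom.mem_ker.mp hs, zero_add]
    rw [← h1, hS, map_sum]
    exact Finset.sum_congr rfl fun p _ => (hμ1 _ _).symm
  · simp only [Submodule.mem_iInf] at ht
    have h1 := RingHom.mem_ker.mp (ht γ (Finset.mem_erase.mpr ⟨hγ, Finset.mem_univ _⟩))
    rw [← h1, hS, map_sum]
    exact Finset.sum_congr rfl fun p _ => (hμ _ _ _).symm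

/-- An invariant ideal of finite codimension contains the intersection of the conjugates of an
ideal whose zeros form an element of `X_*`. -/
theorem exists_orbit_representative_ideal [Finite Γ] (I : Ideal A) [FiniteDimensional ℂ (A ⧸ I)]
    (hI : ∀ (γ : Γ), ∀ f ∈ I, τ γ f ∈ I) :
    ∃ J : Ideal A, {m : MaximalSpectrum A | J ≤ m.asIdeal} ∈ XStar τ ∧
      ∀ f, (∀ γ : Γ, τ γ f ∈ J) → f ∈ I := by
  classical
  cases nonempty_fintype Γ
  have : IsArtinianRing (A ⧸ I) := IsArtinianRing.of_finite ℂ (A ⧸ I)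
  let S : Set (MaximalSpectrum A) := {m | I ≤ m.asIdeal}
  have hSfin : S.Finite := by
    -- The zeros of I inject into the maximal spectrum of an Artinian ring, which is finite.
    let φ : S → MaximalSpectrum (A ⧸ I) := fun m =>
      ⟨m.1.asIdeal.map (Ideal.Quotient.mk I), by
        have := m.1.isMaximal
        refine (Ideal.map_eq_top_or_isMaximal_of_surjective _ Ideal.Quotient.mk_surjective
          this).resolve_left fun h => ?_
        have := congrArg (Ideal.comap (Ideal.Quotient.mk I)) h
        rw [Ideal.comap_map_of_surjective _ Ideal.Quotient.mk_surjective, ← RingHom.ker_eq_comap_bot,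
          Ideal.mk_ker, sup_eq_left.mpr m.2, Ideal.comap_top] at this
        exact m.1.isMaximal.ne_top this⟩
    have hφ : Function.Injective φ := by
      intro m m' h
      have h' := congrArg (fun x => x.asIdeal.comap (Ideal.Quotient.mk I)) h
      simp only [φ] at h'
      rw [Ideal.comap_map_of_surjective _ Ideal.Quotient.mk_surjective,
        Ideal.comap_map_of_surjective _ Ideal.Quotient.mk_surjective,
        ← RingHom.ker_eq_comap_bot, Ideal.mk_ker, sup_eq_left.mpr m.2, sup_eq_left.mpr m'.2] at h'
      exact Subtype.ext (MaximalSpectrum.ext h')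
    have : Finite S := Finite.of_injective φ hφ
    exact S.toFinite
  let r : Setoid (MaximalSpectrum A) :=
    { r := fun m m' => ∃ γ : Γ, maxSpecMap (τ γ) m = m'
      iseqv := ⟨fun m => ⟨1, maxSpecMap_one m⟩,
        fun {m m'} ⟨γ, h⟩ => ⟨γ⁻¹, by rw [← h, ← maxSpecMap_mul, inv_mul_cancel, maxSpecMap_one]⟩,
        fun {m m' m''} ⟨γ, h⟩ ⟨δ, h'⟩ => ⟨δ * γ, by rw [maxSpecMap_mul, h, h']⟩⟩ }
  let rep : MaximalSpectrum A → MaximalSpectrum A := fun m => (Quotient.mk r m).out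
  have hrep : ∀ m, ∃ γ : Γ, maxSpecMap (τ γ) m = rep m := fun m =>
    r.symm (Quotient.mk_out (s := r) m)
  have hrep_eq : ∀ (m : MaximalSpectrum A) (γ : Γ), rep (maxSpecMap (τ γ) m) = rep m := fun m γ =>
    congrArg Quotient.out (Quotient.sound (s := r) (r.symm ⟨γ, rfl⟩))
  have hS : ∀ m ∈ S, ∀ γ : Γ, maxSpecMap (τ γ) m ∈ S := fun m hm γ =>
    
    le_maxSpecMap fun f hf => hm <| by
      rw [← algAut_inv_apply_apply (τ := τ) γ f]
      exact hI _ _ hf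
  -- One zero of I from each orbit of zeros.
  let R : Finset (MaximalSpectrum A) := hSfin.toFinset.filter fun m => rep m = m
  let Q : Ideal A := R.inf MaximalSpectrum.asIdeal
  -- This exponent takes care of I not being radical: a k-th power of the Jacobson radical of I
  -- falls into I.
  obtain ⟨k, hk⟩ := IsArtinianRing.isNilpotent_jacobson_bot (R := A ⧸ I)
  have hkI : I.jacobson ^ k ≤ I := by
    have h := Ideal.comap_jacobson_of_surjective (Ideal.Quotient.mk_surjective (I := I)) (K := ⊥)
    rw [← RingHom.ker_eq_comap_bot, Ideal.mk_ker] at h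
    rw [← h]
    refine (Ideal.le_comap_pow _ k).trans ?_
    rw [hk, Ideal.zero_eq_bot, ← RingHom.ker_eq_comap_bot, Ideal.mk_ker]
  have hX : {m : MaximalSpectrum A | Q ^ k ≤ m.asIdeal} ∈ XStar τ := by
    have hsub : ∀ m : MaximalSpectrum A, Q ^ k ≤ m.asIdeal → m ∈ R := by
      intro m hm
      have := m.isMaximal.isPrime
      obtain ⟨m', hm', hle⟩ := this.inf_le'.mp (Ideal.IsPrime.le_of_pow_le hm)
      rwa [← MaximalSpectrum.ext (m'.isMaximal.eq_of_le m.isMaximal.ne_top hle)]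
    refine ⟨R.finite_toSet.subset hsub, fun m hm m' hm' hne γ h => hne ?_⟩
    rw [← (Finset.mem_filter.mp (hsub m hm)).2, ← (Finset.mem_filter.mp (hsub m' hm')).2, ← h,
      hrep_eq]
  refine ⟨Q ^ k, hX, fun f hf => hkI ?_⟩
  -- The conjugates are pairwise coprime, so their intersection is a product, from which the
  -- exponent k can be pulled out.
  have hprod : f ∈ ∏ γ : Γ, (Q ^ k).comap (τ γ) := by
    rw [Ideal.prod_eq_iInf_of_pairwise_isCoprime fun γ _ δ _ h =>
      isCoprime_comap_comap hfree hX h]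
    simp only [Submodule.mem_iInf]
    exact fun γ _ => hf γ
  have hpow : ∏ γ : Γ, (Q ^ k).comap (τ γ) = (∏ γ : Γ, Q.comap (τ γ)) ^ k := by
    rw [← Finset.prod_pow]
    refine Finset.prod_congr rfl fun γ _ => ?_
    rw [comap_eq_map_inv, comap_eq_map_inv, Ideal.map_pow]
  rw [hpow] at hprod
  refine Ideal.pow_right_mono ?_ k hprod
  refine Ideal.prod_le_inf.trans (le_sInf ?_)
  rintro m ⟨hm, hmax⟩
  -- For each zero m of I, the factor belonging to the γ that carries m to its representative
  -- already lies in m.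
  obtain ⟨γ, hγ⟩ := hrep ⟨m, hmax⟩
  refine (Finset.inf_le (Finset.mem_univ γ)).trans fun a ha => ?_
  have hR : rep ⟨m, hmax⟩ ∈ R := by
    refine Finset.mem_filter.mpr ⟨hSfin.mem_toFinset.mpr (hγ ▸ hS _ hm γ), ?_⟩
    rw [← hγ, hrep_eq, hγ]
  have h1 : τ γ a ∈ (maxSpecMap (τ γ) ⟨m, hmax⟩).asIdeal :=
    hγ ▸ (Finset.inf_le (f := MaximalSpectrum.asIdeal) hR) ha
  have h2 := Ideal.mem_map_of_mem (τ γ⁻¹) h1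
  have h3 : a ∈ (maxSpecMap (τ γ⁻¹) (maxSpecMap (τ γ) ⟨m, hmax⟩)).asIdeal := by
    rwa [← algAut_inv_apply_apply (τ := τ) γ a]
  rwa [← maxSpecMap_mul, inv_mul_cancel, maxSpecMap_one] at h3

end FreeAction

/-! ### Multiplication of coefficients in L ⊗ A, and the subspaces L ⊗ J. -/

section Coefficients

variable {L A : Type*} [AddCommGroup L] [Module ℂ L] [CommRing A] [Algebra ℂ A]

variable (L) in
/-- The operator `x ⊗ f ↦ x ⊗ a f`. -/
def coeffMul (a : A) : L ⊗[ℂ] A →ₗ[ℂ] L ⊗[ℂ] A :=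
  (LinearMap.mulLeft ℂ a).lTensor L

theorem coeffMul_tmul (a : A) (x : L) (f : A) : coeffMul L a (x ⊗ₜ f) = x ⊗ₜ (a * f) := rfl

theorem coeffMul_add (a b : A) (z : L ⊗[ℂ] A) :
    coeffMul L (a + b) z = coeffMul L a z + coeffMul L b z := by
  induction z using TensorProduct.induction_on with
  | zero => simp
  | add x y hx hy => rw [map_add, map_add, map_add, hx, hy]; abel
  | tmul x f => simp only [coeffMul_tmul, add_mul, TensorProduct.tmul_add]

theorem coeffMul_one (z : L ⊗[ℂ] A) : coeffMul L (1 : A) z = z := by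
  simp [coeffMul]

theorem coeffMul_sum {ι : Type*} (s : Finset ι) (a : ι → A) (z : L ⊗[ℂ] A) :
    coeffMul L (∑ i ∈ s, a i) z = ∑ i ∈ s, coeffMul L (a i) z := by
  induction z using TensorProduct.induction_on with
  | zero => simp
  | add x y hx hy => simp only [map_add, hx, hy, Finset.sum_add_distrib]
  | tmul x f => simp only [coeffMul_tmul, Finset.sum_mul, TensorProduct.tmul_sum]

variable (L) in
/-- The subspace `L ⊗ J` of `L ⊗ A`. -/
def tensorIdeal (J : Ideal A) :
    Submodule ℂ (L ⊗[ℂ] A) :=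
  Submodule.span ℂ {z | ∃ x : L, ∃ f ∈ J, z = x ⊗ₜ f}

theorem tmul_mem_tensorIdeal {J : Ideal A} (x : L) {f : A} (hf : f ∈ J) :
    x ⊗ₜ f ∈ tensorIdeal L J := Submodule.subset_span ⟨x, f, hf, rfl⟩

theorem coeffMul_mem_tensorIdeal {J : Ideal A} {a : A} (ha : a ∈ J) (z : L ⊗[ℂ] A) :
    coeffMul L a z ∈ tensorIdeal L J := by
  induction z using TensorProduct.induction_on with
  | zero => rw [map_zero]; exact Submodule.zero_mem _
  | add x y hx hy => rw [map_add]; exact Submodule.add_mem _ hx hy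
  | tmul x f => exact tmul_mem_tensorIdeal x (J.mul_mem_right f ha)

end Coefficients

/-! ### The trace onto the fixed-point subalgebra. -/

section Trace

variable {L A : Type*} [AddCommGroup L] [Module ℂ L] [LieSuperalgebra L] [CommRing A] [Algebra ℂ A]
  {Γ : Type*} [Group Γ] (σ : Γ →* LieSuperalgebra.Aut L) (τ : Γ →* (A ≃ₐ[ℂ] A))

theorem map_bracket_tmul (x y : L) (f g : A) :
    LieSuperalgebra.bracket (x ⊗ₜ[ℂ] f) (y ⊗ₜ[ℂ] g) =
      (LieSuperalgebra.bracket x y) ⊗ₜ[ℂ] (f * g) := rfl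

theorem diagonalAction_tmul (γ : Γ) (x : L) (f : A) :
    diagonalAction σ τ γ (x ⊗ₜ f) = ((σ γ : L ≃ₗ[ℂ] L) x) ⊗ₜ τ γ f := rfl

theorem diagonalAction_mul (γ δ : Γ) (z : L ⊗[ℂ] A) :
    diagonalAction σ τ (γ * δ) z = diagonalAction σ τ γ (diagonalAction σ τ δ z) := by
  induction z using TensorProduct.induction_on with
  | zero => simp
  | add x y hx hy => simp only [map_add, hx, hy]
  | tmul x f => simp only [diagonalAction_tmul, map_mul]; rfl

theorem diagonalAction_one (z : L ⊗[ℂ] A) : diagonalAction σ τ 1 z = z := by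
  induction z using TensorProduct.induction_on with
  | zero => simp
  | add x y hx hy => simp only [map_add, hx, hy]
  | tmul x f => simp only [diagonalAction_tmul, map_one]; rfl

theorem coeffMul_mem_part (a : A) {i : ZMod 2} {z : L ⊗[ℂ] A} (hz : z ∈ part i) :
    coeffMul L a z ∈ part i := by
  refine tensor_part_induction ?_ ?_ ?_ z hz
  · rw [map_zero]; exact Submodule.zero_mem _
  · intro x y h h'
    rw [map_add]
    exact Submodule.add_mem _ h h'
  · intro x hx f
    exact ⟨⟨x, hx⟩ ⊗ₜ (a * f), rfl⟩

theorem diagonalAction_coeffMul (γ : Γ) (a : A) (z : L ⊗[ℂ] A) :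
    diagonalAction σ τ γ (coeffMul L a z) = coeffMul L (τ γ a) (diagonalAction σ τ γ z) := by
  induction z using TensorProduct.induction_on with
  | zero => simp
  | add x y hx hy => simp only [map_add, hx, hy]
  | tmul x f => simp only [diagonalAction_tmul, coeffMul_tmul, map_mul]

theorem bracket_mem_tensorIdeal_right {J : Ideal A} (w : L ⊗[ℂ] A) {z : L ⊗[ℂ] A}
    (hz : z ∈ tensorIdeal L J) : LieSuperalgebra.bracket w z ∈ tensorIdeal L J := by
  induction hz using Submodule.span_induction with
  | zero => rw [map_zero]; exact Submodule.zero_mem _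
  | add x y _ _ hx hy => rw [map_add]; exact Submodule.add_mem _ hx hy
  | smul c x _ hx => rw [map_smul]; exact Submodule.smul_mem _ c hx
  | mem z hz =>
    obtain ⟨x, f, hf, rfl⟩ := hz
    induction w using TensorProduct.induction_on with
    | zero => rw [map_zero]; exact Submodule.zero_mem _
    | add u v hu hv => rw [map_add, LinearMap.add_apply]; exact Submodule.add_mem _ hu hv
    | tmul y g =>
      rw [map_bracket_tmul]
      exact tmul_mem_tensorIdeal _ (J.mul_mem_left g hf)

theorem bracket_mem_tensorIdeal_left {J : Ideal A} (w : L ⊗[ℂ] A) {z : L ⊗[ℂ] A}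
    (hz : z ∈ tensorIdeal L J) : LieSuperalgebra.bracket z w ∈ tensorIdeal L J := by
  induction hz using Submodule.span_induction with
  | zero => rw [map_zero]; exact Submodule.zero_mem _
  | add x y _ _ hx hy => rw [map_add, LinearMap.add_apply]; exact Submodule.add_mem _ hx hy
  | smul c x _ hx => rw [map_smul, LinearMap.smul_apply]; exact Submodule.smul_mem _ c hx
  | mem z hz =>
    obtain ⟨x, f, hf, rfl⟩ := hz
    induction w using TensorProduct.induction_on with
    | zero => rw [map_zero]; exact Submodule.zero_mem _
    | add u v hu hv => rw [map_add]; exact Submodule.add_mem _ hu hv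
    | tmul y g =>
      rw [map_bracket_tmul]
      exact tmul_mem_tensorIdeal _ (J.mul_mem_right g hf)

variable [Fintype Γ]

/-- The map `z ↦ ∑ γ z` from `L ⊗ A` onto `(L ⊗ A)^Γ`. -/
def traceMap : L ⊗[ℂ] A →ₗ[ℂ] (equivariantMap σ τ).toSubmodule :=
  LinearMap.codRestrict _ (∑ γ : Γ, diagonalAction σ τ γ) fun z γ => by
    rw [LinearMap.sum_apply, map_sum]
    simp only [← diagonalAction_mul]
    exact Fintype.sum_equiv (Equiv.mulLeft γ) _ _ fun _ => rfl

theorem traceMap_coe (z : L ⊗[ℂ] A) :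
    (traceMap σ τ z : L ⊗[ℂ] A) = ∑ γ : Γ, diagonalAction σ τ γ z :=
  LinearMap.sum_apply _ _ _

theorem traceMap_mem_part {i : ZMod 2} {z : L ⊗[ℂ] A} (hz : z ∈ part i) :
    traceMap σ τ z ∈ part i := by
  change (traceMap σ τ z : L ⊗[ℂ] A) ∈ part i
  rw [traceMap_coe]
  exact Submodule.sum_mem _ fun γ _ => diagonalAction_mem_part σ τ γ i z hz

theorem traceMap_of_mem (z : (equivariantMap σ τ).toSubmodule) :
    traceMap σ τ z = (Fintype.card Γ : ℂ) • z := by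
  refine Subtype.ext ?_
  rw [traceMap_coe, Finset.sum_congr rfl fun γ _ => z.2 γ]
  simp [Nat.cast_smul_eq_nsmul]

theorem traceMap_diagonalAction (γ : Γ) (z : L ⊗[ℂ] A) :
    traceMap σ τ (diagonalAction σ τ γ z) = traceMap σ τ z := by
  refine Subtype.ext ?_
  rw [traceMap_coe, traceMap_coe]
  simp only [← diagonalAction_mul]
  exact Fintype.sum_equiv (Equiv.mulRight γ) _ _ fun _ => rfl

theorem traceMap_coeffMul_of_mem (a : A) {z : L ⊗[ℂ] A} (hz : z ∈ (equivariantMap σ τ).toSubmodule) :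
    (traceMap σ τ (coeffMul L a z) : L ⊗[ℂ] A) = coeffMul L (∑ γ, τ γ a) z := by
  rw [traceMap_coe, coeffMul_sum]
  exact Finset.sum_congr rfl fun γ _ => by rw [diagonalAction_coeffMul, hz γ]

/-- Modulo `L ⊗ J`, the trace weighted by a separating element is the identity. -/
theorem traceMap_coeffMul_sub_mem {J : Ideal A} {e : A} (he : 1 - e ∈ J)
    (he' : ∀ γ : Γ, γ ≠ 1 → τ γ e ∈ J) (z : L ⊗[ℂ] A) :
    (traceMap σ τ (coeffMul L e z) : L ⊗[ℂ] A) - z ∈ tensorIdeal L J := by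
  classical
  rw [traceMap_coe, ← Finset.add_sum_erase _ _ (Finset.mem_univ (1 : Γ)), diagonalAction_one]
  -- The summand for γ = 1 differs from z by a term with coefficient 1 - e in J; the other summands
  -- have coefficients γ(e) in J.
  have h1 : coeffMul L e z = z - coeffMul L (1 - e) z := by
    rw [eq_sub_iff_add_eq, ← coeffMul_add, add_sub_cancel, coeffMul_one]
  rw [h1, add_sub_right_comm, sub_sub_cancel_left]
  refine Submodule.add_mem _ (Submodule.neg_mem _ (coeffMul_mem_tensorIdeal he z)) ?_
  rw [← h1]
  refine Submodule.sum_mem _ fun γ hγ => ?_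
  rw [diagonalAction_coeffMul]
  exact coeffMul_mem_tensorIdeal (he' γ (Finset.ne_of_mem_erase hγ)) _

/-- The bracket of traces, computed with a Galois element. -/
theorem traceMap_bracket_tmul {S : Finset (A × A)} (h1 : ∑ p ∈ S, p.1 * p.2 = 1)
    (hS : ∀ γ : Γ, γ ≠ 1 → ∑ p ∈ S, p.1 * τ γ p.2 = 0) (u v : L) (f g : A) :
    traceMap σ τ (LieSuperalgebra.bracket u v ⊗ₜ (f * g)) =
      ∑ p ∈ S, LieSuperalgebra.bracket (traceMap σ τ (u ⊗ₜ (f * p.1)))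
        (traceMap σ τ (v ⊗ₜ (p.2 * g))) := by
  classical
  have hS' : ∀ γ : Γ, ∑ p ∈ S, p.1 * τ γ p.2 = if γ = 1 then 1 else 0 := by
    intro γ
    split_ifs with h
    · rw [h, map_one]; exact h1
    · exact hS γ h
  -- Each γ fixes the second trace, so the bracket of γ(x) with it is γ applied to the bracket of x
  -- with it. Only then is the second trace expanded over δ.
  have hsum : ∀ p : A × A, (LieSuperalgebra.bracket (traceMap σ τ (u ⊗ₜ[ℂ] (f * p.1)))
      (traceMap σ τ (v ⊗ₜ[ℂ] (p.2 * g))) : (equivariantMap σ τ).toSubmodule).1 =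
      ∑ γ : Γ, ∑ δ : Γ, diagonalAction σ τ γ
        (LieSuperalgebra.bracket u ((σ δ : L ≃ₗ[ℂ] L) v) ⊗ₜ[ℂ] ((f * τ δ g) * (p.1 * τ δ p.2))) := by
    intro p
    change LieSuperalgebra.bracket (traceMap σ τ (u ⊗ₜ[ℂ] (f * p.1)) : L ⊗[ℂ] A)
      (traceMap σ τ (v ⊗ₜ[ℂ] (p.2 * g)) : L ⊗[ℂ] A) = _
    rw [traceMap_coe, map_sum, LinearMap.sum_apply]
    refine Finset.sum_congr rfl fun γ _ => ?_
    rw [← traceMap_diagonalAction σ τ γ⁻¹, ← (traceMap σ τ _).2 γ, ← diagonalAction_bracket,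
      traceMap_diagonalAction, traceMap_coe, map_sum, map_sum]
    refine Finset.sum_congr rfl fun δ _ => ?_
    rw [diagonalAction_tmul, map_bracket_tmul, map_mul]
    congr 2
    ring
  refine Subtype.ext ?_
  rw [AddSubmonoidClass.coe_finsetSum, Finset.sum_congr rfl fun p _ => hsum p, Finset.sum_comm,
    traceMap_coe]
  refine Finset.sum_congr rfl fun γ _ => ?_
  -- Summing over p first, the Galois relations leave only the term δ = 1.
  rw [Finset.sum_comm, Finset.sum_eq_single 1]
  · rw [← map_sum, ← TensorProduct.tmul_sum, ← Finset.mul_sum, hS', if_pos rfl, mul_one, map_one,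
      map_one]
    rfl
  · intro δ _ hδ
    rw [← map_sum, ← TensorProduct.tmul_sum, ← Finset.mul_sum, hS', if_neg hδ, mul_zero,
      TensorProduct.tmul_zero, map_zero]
  · simp

end Trace

/-! ### Perfectness of the queer Lie superalgebra. -/

section Perfect

/-- Every element is a sum of brackets. -/
def LieSuperalgebra.IsPerfect (L : Type*) [AddCommGroup L] [Module ℂ L] [LieSuperalgebra L] :
    Prop :=
  Submodule.span ℂ {z : L | ∃ x y, z = LieSuperalgebra.bracket x y} = ⊤

/-- Matrix units suffice: E_ij = [E_ii, E_ij] for i ≠ j, and E_ii - E_00 = [E_i0, E_0i]. The second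
factor is kept traceless so that it can be the block of an odd element. -/
theorem traceless_mem_span_commutators {m : ℕ} (B : Matrix (Fin (m + 1)) (Fin (m + 1)) ℂ)
    (hB : B.trace = 0) :
    B ∈ Submodule.span ℂ {Z | ∃ X Y : Matrix (Fin (m + 1)) (Fin (m + 1)) ℂ,
      Y.trace = 0 ∧ Z = X * Y - Y * X} := by
  classical
  set P := Submodule.span ℂ {Z | ∃ X Y : Matrix (Fin (m + 1)) (Fin (m + 1)) ℂ,
      Y.trace = 0 ∧ Z = X * Y - Y * X} with hP
  have hoff : ∀ i j, i ≠ j → Matrix.single i j (1 : ℂ) ∈ P := fun i j h =>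
    Submodule.subset_span ⟨Matrix.single i i 1, Matrix.single i j 1,
      Matrix.trace_single_eq_of_ne i j 1 h, by
        rw [Matrix.single_mul_single_same, Matrix.single_mul_single_of_ne _ _ _ _ h.symm]; simp⟩
  have hdiag : ∀ i, Matrix.single i i (1 : ℂ) - Matrix.single 0 0 1 ∈ P := fun i => by
    by_cases h : i = 0
    · rw [h, sub_self]; exact P.zero_mem
    · exact Submodule.subset_span ⟨Matrix.single i 0 1, Matrix.single 0 i 1,
        Matrix.trace_single_eq_of_ne 0 i 1 (Ne.symm h), by
          rw [Matrix.single_mul_single_same, Matrix.single_mul_single_same]; simp⟩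
  -- The corrections by E_00 add up to tr(B) E_00 = 0.
  have hsum : B = ∑ i, ∑ j, B i j • (Matrix.single i j (1 : ℂ) -
      if i = j then Matrix.single 0 0 1 else 0) := by
    simp only [smul_sub, Finset.sum_sub_distrib, smul_ite, smul_zero, Finset.sum_ite_eq,
      Finset.mem_univ, if_true, ← Finset.sum_smul]
    have : ∑ i, B i i = 0 := hB
    rw [this, zero_smul, sub_zero]
    conv_lhs => rw [Matrix.matrix_eq_sum_single B]
    simp [Matrix.smul_single]
  rw [hsum]
  refine P.sum_mem fun i _ => P.sum_mem fun j _ => P.smul_mem _ ?_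
  split_ifs with h
  · subst h; exact hdiag i
  · rw [sub_zero]; exact hoff i j h

/-- Brackets of two even elements give the traceless even blocks, which are all the even blocks
modulo scalars; brackets of an even and an odd element give the odd part. -/
theorem queer_isPerfect (n : ℕ) : LieSuperalgebra.IsPerfect (Queer n) := by
  set P := Submodule.span ℂ {z : Queer n | ∃ x y, z = LieSuperalgebra.bracket x y} with hP
  let ι : (queerTilde n).toSubmodule →ₗ[ℂ] Queer n := (queerCenter n).toSubmodule.mkQ
  let E : Matrix (Fin (n + 1)) (Fin (n + 1)) ℂ →ₗ[ℂ] (queerTilde n).toSubmodule :=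
    { toFun := fun X => ⟨Matrix.fromBlocks X 0 0 X, X, 0, by simp, rfl⟩
      map_add' := fun X Y => Subtype.ext (by simp [Matrix.fromBlocks_add])
      map_smul' := fun c X => Subtype.ext (by simp [Matrix.fromBlocks_smul]) }
  have heven : ∀ X Y, ι (E (X * Y - Y * X)) ∈ P := fun X Y =>
    Submodule.subset_span ⟨ι (E X), ι (E Y), congrArg ι (Subtype.ext (by
      change _ = SuperMatrix.superCommutator (Matrix.fromBlocks X 0 0 X : SuperMatrix _ _)
        (Matrix.fromBlocks Y 0 0 Y)
      rw [SuperMatrix.superCommutator_queer]; simp [E]))⟩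
  have heven' : ∀ B : Matrix (Fin (n + 1)) (Fin (n + 1)) ℂ, B.trace = 0 → ι (E B) ∈ P := by
    intro B hB
    change B ∈ P.comap (ι ∘ₗ E)
    refine Submodule.span_le.mpr ?_ (traceless_mem_span_commutators B hB)
    rintro _ ⟨X, Y, -, rfl⟩
    exact heven X Y
  have hone : ι (E 1) = 0 := (Submodule.Quotient.mk_eq_zero _).mpr (by
    change (Matrix.fromBlocks 1 0 0 1 : SuperMatrix (n + 1) (n + 1)) ∈ Submodule.span ℂ {1}
    rw [Matrix.fromBlocks_one]
    exact Submodule.mem_span_singleton_self _)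
  have hall : ∀ B : Matrix (Fin (n + 1)) (Fin (n + 1)) ℂ, ι (E B) ∈ P := by
    intro B
    have h := heven' (B - (B.trace / (n + 1)) • 1) (by
      have : (n + 1 : ℂ) ≠ 0 := by exact_mod_cast n.succ_ne_zero
      simp only [Matrix.trace_sub, Matrix.trace_smul, Matrix.trace_one, Fintype.card_fin,
        smul_eq_mul]
      push_cast
      field_simp
      ring)
    rwa [map_sub, map_sub, map_smul, map_smul, hone, smul_zero, sub_zero] at h
  let F : LinearMap.ker (Matrix.traceLinearMap (Fin (n + 1)) ℂ ℂ) →ₗ[ℂ]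
      (queerTilde n).toSubmodule :=
    { toFun := fun X => ⟨Matrix.fromBlocks 0 X.1 X.1 0, 0, X.1, X.2, rfl⟩
      map_add' := fun X Y => Subtype.ext (by simp [Matrix.fromBlocks_add])
      map_smul' := fun c X => Subtype.ext (by simp [Matrix.fromBlocks_smul]) }
  have hodd : ∀ B, ι (F B) ∈ P := by
    intro B
    have key : ∀ Z ∈ Submodule.span ℂ {Z | ∃ X Y : Matrix (Fin (n + 1)) (Fin (n + 1)) ℂ,
        Y.trace = 0 ∧ Z = X * Y - Y * X}, ∀ hZ : Z.trace = 0, ι (F ⟨Z, hZ⟩) ∈ P := by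
      intro Z hZ
      -- The span lies in the space of all matrices, but `F` is defined only on traceless ones; the
      -- image under the inclusion transfers the claim to the generators.
      have : Z ∈ (P.comap (ι ∘ₗ F)).map (Submodule.subtype _) := by
        refine Submodule.span_le.mpr ?_ hZ
        rintro _ ⟨X, Y, hY, rfl⟩
        refine ⟨⟨X * Y - Y * X, ?_⟩, ?_, rfl⟩
        · simp [Matrix.trace_mul_comm X Y]
        · refine Submodule.subset_span ⟨ι (E X), ι (F ⟨Y, hY⟩), congrArg ι (Subtype.ext ?_)⟩
          change _ = SuperMatrix.superCommutator (Matrix.fromBlocks X 0 0 X : SuperMatrix _ _)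
            (Matrix.fromBlocks 0 Y Y 0)
          rw [SuperMatrix.superCommutator_queer]
          simp [F]
      obtain ⟨W, hW, rfl⟩ := this
      exact fun _ => hW
    exact key B.1 (traceless_mem_span_commutators B.1 B.2) B.2
  refine eq_top_iff.mpr fun z _ => ?_
  obtain ⟨⟨_, X, Y, hY, rfl⟩, rfl⟩ := (queerCenter n).toSubmodule.mkQ_surjective z
  have : (⟨Matrix.fromBlocks X Y Y X, X, Y, hY, rfl⟩ : (queerTilde n).toSubmodule) =
      E X + F ⟨Y, hY⟩ := Subtype.ext (by simp [E, F, Matrix.fromBlocks_add])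
  rw [this, map_add]
  exact P.add_mem (hall X) (hodd _)

end Perfect

/-! ### Restriction and extension of modules. -/

section Modules

namespace SuperRep

theorem ext_act {L V : Type*} [AddCommGroup L] [Module ℂ L] [LieSuperalgebra L]
    [AddCommGroup V] [Module ℂ V] [SuperSpace V] {ρ ρ' : SuperRep L V} (h : ρ.act = ρ'.act) :
    ρ = ρ' := by
  cases ρ; cases ρ'; cases h; rfl

/-- Both terms of xy ± yx contain x. The element y is split because the sign rule holds only for
homogeneous elements. -/
theorem act_bracket_eq_zero {L V : Type*} [AddCommGroup L] [Module ℂ L] [LieSuperalgebra L]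
    [AddCommGroup V] [Module ℂ V] [SuperSpace V] (ρ : SuperRep L V) {i : ZMod 2} {x : L}
    (hi : x ∈ part i) (hx : ρ.act x = 0) (y : L) : ρ.act (LieSuperalgebra.bracket x y) = 0 := by
  obtain ⟨a, ha, b, hb, rfl⟩ := exists_decomp y
  ext v
  rw [map_add, map_add, LinearMap.add_apply, ρ.act_bracket i 0 x a hi ha,
    ρ.act_bracket i 1 x b hi hb, hx]
  simp

/-- The condition that the image of a linear map between modules determines irreducibility. -/
theorem isIrreducible_congr {L L' V : Type*} [AddCommGroup L] [Module ℂ L] [LieSuperalgebra L]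
    [AddCommGroup L'] [Module ℂ L'] [LieSuperalgebra L']
    [AddCommGroup V] [Module ℂ V] [SuperSpace V] (ρ : SuperRep L V) (ρ' : SuperRep L' V)
    (h : ∀ x, ∃ y, ρ.act x = ρ'.act y) (h' : ∀ y, ∃ x, ρ'.act y = ρ.act x) :
    ρ.IsIrreducible ↔ ρ'.IsIrreducible := by
  have key : ∀ W : Submodule ℂ V, (∀ x : L, ∀ w ∈ W, ρ.act x w ∈ W) ↔
      ∀ y : L', ∀ w ∈ W, ρ'.act y w ∈ W := fun W =>
    ⟨fun H y w hw => by obtain ⟨x, hx⟩ := h' y; rw [hx]; exact H x w hw,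
      fun H x w hw => by obtain ⟨y, hy⟩ := h x; rw [hy]; exact H y w hw⟩
  simp only [IsIrreducible, key]

variable {L A V : Type*} [AddCommGroup L] [Module ℂ L] [LieSuperalgebra L]
  [CommRing A] [Algebra ℂ A] [AddCommGroup V] [Module ℂ V] [SuperSpace V]

/-- The annihilator is a supremum of ideals, so a single ideal `K` of elements acting by zero must
bound them all; asking for all multiples f a makes `K` an ideal. -/
theorem act_tmul_eq_zero_of_mem_annihilator (ρ : SuperRep (L ⊗[ℂ] A) V) (x : L) {f : A}
    (hf : f ∈ ρ.annihilator) : ρ.act (x ⊗ₜ f) = 0 := by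
  let K : Ideal A :=
    { carrier := {f | ∀ x : L, ∀ a : A, ρ.act (x ⊗ₜ (f * a)) = 0}
      add_mem' := fun hf hg x a => by
        rw [add_mul, TensorProduct.tmul_add, map_add, hf x a, hg x a, add_zero]
      zero_mem' := fun x a => by rw [zero_mul, TensorProduct.tmul_zero, map_zero]
      smul_mem' := fun c f hf x a => by
        rw [smul_eq_mul, mul_comm c, mul_assoc]
        exact hf x _ }
  have hle : ρ.annihilator ≤ K :=
    sSup_le fun I hI f hf x a => hI x _ (I.mul_mem_right a hf)
  simpa using hle hf x 1

theorem act_eq_zero_of_mem_tensorIdeal (ρ : SuperRep (L ⊗[ℂ] A) V) {z : L ⊗[ℂ] A}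
    (hz : z ∈ tensorIdeal L ρ.annihilator) : ρ.act z = 0 := by
  refine (Submodule.span_le (p := LinearMap.ker ρ.act)).mpr ?_ hz
  rintro _ ⟨x, f, hf, rfl⟩
  exact ρ.act_tmul_eq_zero_of_mem_annihilator x hf

variable {Γ : Type*} [Group Γ] {σ : Γ →* LieSuperalgebra.Aut L} {τ : Γ →* (A ≃ₐ[ℂ] A)}

/-- A module with support in `X_*` has the same irreducibility as its restriction. -/
theorem restrict_isIrreducible_iff [Finite Γ]
    (hfree : ∀ (γ : Γ) (m : MaximalSpectrum A), maxSpecMap (τ γ) m = m → γ = 1)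
    (ρ : SuperRep (L ⊗[ℂ] A) V) (hρ : ρ.support ∈ XStar τ) :
    (ρ.restrict (equivariantMap σ τ)).IsIrreducible ↔ ρ.IsIrreducible := by
  cases nonempty_fintype Γ
  -- The support is by definition the zero set of the annihilator, which plays the role of J.
  obtain ⟨e, he, he'⟩ := exists_separating hfree hρ
  refine isIrreducible_congr _ _ (fun x => ⟨x.1, rfl⟩) fun z =>
    ⟨traceMap σ τ (coeffMul L e z), ?_⟩
  change ρ.act z = ρ.act (traceMap σ τ (coeffMul L e z) : L ⊗[ℂ] A)
  rw [eq_comm, ← sub_eq_zero, ← map_sub]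
  exact ρ.act_eq_zero_of_mem_tensorIdeal (traceMap_coeffMul_sub_mem σ τ he he' z)

/-- The largest ideal `I` such that all traces of elements of `L ⊗ I` act by zero. -/
def traceAnnihilator [Fintype Γ] (ρ : SuperRep (equivariantMap σ τ).toSubmodule V) : Ideal A where
  carrier := {f | ∀ x : L, ∀ a : A, ρ.act (traceMap σ τ (x ⊗ₜ (f * a))) = 0}
  add_mem' := fun hf hg x a => by
    rw [add_mul, TensorProduct.tmul_add, map_add, map_add, hf x a, hg x a, add_zero]
  zero_mem' := fun x a => by rw [zero_mul, TensorProduct.tmul_zero, map_zero, map_zero]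
  smul_mem' := fun c f hf x a => by
    rw [smul_eq_mul, mul_comm c, mul_assoc]
    exact hf x _

variable [Fintype Γ] (ρ : SuperRep (equivariantMap σ τ).toSubmodule V)

theorem act_traceMap_eq_zero {z : L ⊗[ℂ] A} (hz : z ∈ tensorIdeal L ρ.traceAnnihilator) :
    ρ.act (traceMap σ τ z) = 0 := by
  refine (Submodule.span_le (p := LinearMap.ker (ρ.act ∘ₗ traceMap σ τ))).mpr ?_ hz
  rintro _ ⟨x, f, hf, rfl⟩
  have h := hf x 1
  rwa [mul_one] at h

/-- The trace does not see the diagonal action, so γ⁻¹ may be applied to the argument. -/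
theorem map_mem_traceAnnihilator (γ : Γ) {f : A} (hf : f ∈ ρ.traceAnnihilator) :
    τ γ f ∈ ρ.traceAnnihilator := by
  intro x a
  rw [← traceMap_diagonalAction σ τ γ⁻¹, diagonalAction_tmul, map_mul, algAut_inv_apply_apply]
  exact hf _ _

/-- Being in the ideal involves all multiples f a, but finitely many linear conditions are enough.
If the traces of x ⊗ f p₁ act by zero for all x and all p in a Galois element, then for every a the
trace of [u,v] ⊗ fa is a sum of brackets whose first entry acts by zero; perfectness covers all of
L. -/
theorem finiteDimensional_quotient_traceAnnihilator [FiniteDimensional ℂ L]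
    [FiniteDimensional ℂ V] (hL : LieSuperalgebra.IsPerfect L)
    (hfree : ∀ (γ : Γ) (m : MaximalSpectrum A), maxSpecMap (τ γ) m = m → γ = 1) :
    FiniteDimensional ℂ (A ⧸ ρ.traceAnnihilator) := by
  obtain ⟨S, hS1, hS⟩ := exists_galois_element hfree
  let Φ : A →ₗ[ℂ] (S → (L →ₗ[ℂ] V →ₗ[ℂ] V)) := LinearMap.pi fun p =>
    LinearMap.compRight ℂ (ρ.act ∘ₗ traceMap σ τ) ∘ₗ (TensorProduct.mk ℂ L A).flip ∘ₗ
      LinearMap.mulRight ℂ p.1.1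
  have hΦ : ∀ f ∈ LinearMap.ker Φ, ∀ x : L, ∀ p ∈ S,
      ρ.act (traceMap σ τ (x ⊗ₜ (f * p.1))) = 0 := fun f hf x p hp =>
    LinearMap.congr_fun (congrFun (LinearMap.mem_ker.mp hf) ⟨p, hp⟩) x
  have hle : LinearMap.ker Φ ≤ ρ.traceAnnihilator.restrictScalars ℂ := by
    intro f hf x a
    have hx : x ∈ Submodule.span ℂ {z : L | ∃ x y, z = LieSuperalgebra.bracket x y} :=
      hL ▸ Submodule.mem_top
    induction hx using Submodule.span_induction with
    | zero => rw [TensorProduct.zero_tmul, map_zero, map_zero]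
    | add x y _ _ hx hy => rw [TensorProduct.add_tmul, map_add, map_add, hx, hy, add_zero]
    | smul c x _ hx => rw [← TensorProduct.smul_tmul', map_smul, map_smul, hx, smul_zero]
    | mem z hz =>
      obtain ⟨u, v, rfl⟩ := hz
      rw [traceMap_bracket_tmul σ τ hS1 hS, map_sum]
      refine Finset.sum_eq_zero fun p hp => ?_
      obtain ⟨b, hb, c, hc, rfl⟩ := exists_decomp u
      have hzero : ∀ (i : ZMod 2) (b : L), b ∈ part i → ρ.act (LieSuperalgebra.bracket
          (traceMap σ τ (b ⊗ₜ (f * p.1))) (traceMap σ τ (v ⊗ₜ (p.2 * a)))) = 0 := fun i b hb =>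
        ρ.act_bracket_eq_zero (i := i) (traceMap_mem_part σ τ ⟨⟨b, hb⟩ ⊗ₜ (f * p.1), rfl⟩)
          (hΦ f hf b p hp) _
      rw [TensorProduct.add_tmul, map_add, map_add, LinearMap.add_apply, map_add, hzero 0 b hb,
        hzero 1 c hc, add_zero]
  have hfin : FiniteDimensional ℂ (A ⧸ LinearMap.ker Φ) :=
    Module.Finite.equiv Φ.quotKerEquivRange.symm
  have hfin' : FiniteDimensional ℂ (A ⧸ ρ.traceAnnihilator.restrictScalars ℂ) :=
    Module.Finite.of_surjective (Submodule.factor hle) (Submodule.factor_surjective hle)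
  exact hfin'

/-- Every finite-dimensional module of `(L ⊗ A)^Γ` is the restriction of a module of `L ⊗ A` with
support in `X_*`. -/
theorem exists_restrict_eq [FiniteDimensional ℂ L] [FiniteDimensional ℂ V]
    (hL : LieSuperalgebra.IsPerfect L)
    (hfree : ∀ (γ : Γ) (m : MaximalSpectrum A), maxSpecMap (τ γ) m = m → γ = 1) :
    ∃ ρ' : SuperRep (L ⊗[ℂ] A) V,
      ρ'.restrict (equivariantMap σ τ) = ρ ∧ ρ'.support ∈ XStar τ := by
  classical
  have := ρ.finiteDimensional_quotient_traceAnnihilator hL hfree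
  obtain ⟨J, hJ, hJI⟩ := exists_orbit_representative_ideal hfree ρ.traceAnnihilator
    fun γ f hf => ρ.map_mem_traceAnnihilator γ hf
  obtain ⟨e, he, he'⟩ := exists_separating hfree hJ
  -- This element is invariant and lies in J, hence in all conjugates of J, and so in the trace
  -- annihilator.
  let c : A := 1 - ∑ γ, τ γ e
  have hc : c ∈ ρ.traceAnnihilator := by
    refine hJI c fun γ => ?_
    have hinv : τ γ c = c := by
      simp only [c, map_sub, map_one, map_sum, ← algAut_mul_apply]
      congr 1
      exact Fintype.sum_equiv (Equiv.mulLeft γ) _ _ fun _ => rfl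
    rw [hinv]
    simp only [c]
    rw [← Finset.add_sum_erase _ _ (Finset.mem_univ (1 : Γ)), map_one, ← sub_sub]
    exact J.sub_mem he (J.sum_mem fun δ hδ => he' δ (Finset.ne_of_mem_erase hδ))
  -- For fixed z one has z = tr(e z) + c z. The coefficients of e z lie in eJ, all of whose
  -- conjugates are in J, so tr(e z) acts by zero. The term c z is handled by one more trace, at the
  -- cost of the factor |Γ|, invertible over ℂ.
  have hker : ∀ z : (equivariantMap σ τ).toSubmodule, z.1 ∈ tensorIdeal L J → ρ.act z = 0 := by
    intro z hz
    have h1 : ρ.act (traceMap σ τ (coeffMul L e z)) = 0 := by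
      refine ρ.act_traceMap_eq_zero ?_
      refine (Submodule.span_le (p := (tensorIdeal L ρ.traceAnnihilator).comap
        (coeffMul L e))).mpr ?_ hz
      rintro _ ⟨x, f, hf, rfl⟩
      refine tmul_mem_tensorIdeal x (hJI _ fun γ => ?_)
      rw [LinearMap.mulLeft_apply, map_mul]
      by_cases h : γ = 1
      · rw [h, map_one]; exact J.mul_mem_left _ hf
      · exact J.mul_mem_right _ (he' γ h)
    have h2 : ρ.act (traceMap σ τ (coeffMul L c z)) = 0 :=
      ρ.act_traceMap_eq_zero (coeffMul_mem_tensorIdeal hc _)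
    have h3 : (Fintype.card Γ : ℂ) • z = (Fintype.card Γ : ℂ) • traceMap σ τ (coeffMul L e z) +
        traceMap σ τ (coeffMul L c z) := by
      have h : z.1 = (traceMap σ τ (coeffMul L e z)).1 + coeffMul L c z.1 := by
        rw [traceMap_coeffMul_of_mem σ τ e z.2, ← coeffMul_add, add_sub_cancel, coeffMul_one]
      rw [← traceMap_of_mem, ← traceMap_of_mem, ← map_add, ← h]
    have h4 := congrArg ρ.act h3
    rw [map_add, map_smul, map_smul, h1, h2, smul_zero, add_zero] at h4
    exact (smul_eq_zero.mp h4).resolve_left (Nat.cast_ne_zero.mpr Fintype.card_ne_zero)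
  let P : L ⊗[ℂ] A →ₗ[ℂ] (equivariantMap σ τ).toSubmodule := traceMap σ τ ∘ₗ coeffMul L e
  have hP : ∀ z, (P z).1 - z ∈ tensorIdeal L J := traceMap_coeffMul_sub_mem σ τ he he'
  have hPpart : ∀ (i : ZMod 2) (z : L ⊗[ℂ] A), z ∈ part i → P z ∈ part i := fun i z hz =>
    traceMap_mem_part σ τ (coeffMul_mem_part e hz)
  -- `P` need not be a homomorphism, but its defect is a fixed element of L ⊗ J, and `hker` applies.
  have hPbracket : ∀ z w, ρ.act (P (LieSuperalgebra.bracket z w)) =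
      ρ.act (LieSuperalgebra.bracket (P z) (P w)) := by
    intro z w
    rw [← sub_eq_zero, ← map_sub]
    refine hker _ ?_
    change (P (LieSuperalgebra.bracket z w)).1 -
      LieSuperalgebra.bracket (P z).1 (P w).1 ∈ tensorIdeal L J
    have h : (P (LieSuperalgebra.bracket z w)).1 - LieSuperalgebra.bracket (P z).1 (P w).1 =
        ((P (LieSuperalgebra.bracket z w)).1 - LieSuperalgebra.bracket z w) -
          (LieSuperalgebra.bracket ((P z).1 - z) (P w).1 +
            LieSuperalgebra.bracket z ((P w).1 - w)) := by
      simp only [map_sub, LinearMap.sub_apply]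
      abel
    rw [h]
    exact Submodule.sub_mem _ (hP _) (Submodule.add_mem _
      (bracket_mem_tensorIdeal_left _ (hP z)) (bracket_mem_tensorIdeal_right _ (hP w)))
  let ρ' : SuperRep (L ⊗[ℂ] A) V :=
    { act := ρ.act ∘ₗ P
      act_mem := fun i j x v hx hv => ρ.act_mem i j (P x) v (hPpart i x hx) hv
      act_bracket := fun i j x y hx hy v => by
        rw [LinearMap.comp_apply, hPbracket]
        exact ρ.act_bracket i j (P x) (P y) (hPpart i x hx) (hPpart j y hy) v }
  have hann : J ≤ ρ'.annihilator := le_sSup fun x f hf => by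
    refine hker _ ?_
    have h := Submodule.add_mem _ (hP (x ⊗ₜ f)) (tmul_mem_tensorIdeal x hf)
    rwa [sub_add_cancel] at h
  refine ⟨ρ', ext_act (LinearMap.ext fun z => ?_), ?_⟩
  · change ρ.act (P z.1) = ρ.act z
    rw [← sub_eq_zero, ← map_sub]
    exact hker _ (hP z.1)
  -- The support lies in the zero set of J, and X_* is closed under passing to subsets.
  · exact ⟨hJ.1.subset fun m hm => hann.trans hm, fun m hm m' hm' =>
      hJ.2 m (hann.trans hm) m' (hann.trans hm')⟩

end SuperRep

end Modules

end

theorem proposition7p2 (n : ℕ) (hn : 2 ≤ n)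
    {A : Type*} [CommRing A] [Algebra ℂ A] [Algebra.FiniteType ℂ A]
    {Γ : Type*} [CommGroup Γ] [Finite Γ]
    (σ : Γ →* LieSuperalgebra.Aut (Queer n)) (τ : Γ →* (A ≃ₐ[ℂ] A))
    (hfree : ∀ (γ : Γ) (m : MaximalSpectrum A), maxSpecMap (τ γ) m = m → γ = 1)
    {V : Type*} [AddCommGroup V] [Module ℂ V] [FiniteDimensional ℂ V] [SuperSpace V]
    (ρ : SuperRep (equivariantMap σ τ).toSubmodule V) :
    (∃ ρ' : SuperRep (Queer n ⊗[ℂ] A) V,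
      ρ'.restrict (equivariantMap σ τ) = ρ ∧ ρ'.support ∈ XStar τ) ∧
    ∀ ρ' : SuperRep (Queer n ⊗[ℂ] A) V,
      ρ'.restrict (equivariantMap σ τ) = ρ → ρ'.support ∈ XStar τ →
        (ρ.IsIrreducible ↔ ρ'.IsIrreducible) := by
  cases nonempty_fintype Γ
  refine ⟨ρ.exists_restrict_eq (queer_isPerfect n) hfree, ?_⟩
  rintro ρ' rfl hρ'
  exact ρ'.restrict_isIrreducible_iff hfree hρ'
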